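/- All graphs are finite, simple and connected. Let $G=(V,E)$ be a graph and let $\sigma$ be a reflection of $G$, i.e. an automorphism of $G$ with $\sigma\neq\mathrm{id}$ and $\sigma^2=\mathrm{id}$. A realisation of $G$ is a map $p:V\to\mathbb R^2$ with $p(u)\ne p(v)$ for each $uv\in E$; the framework $(G,p)$ is reflection-symmetric (with reflection $\sigma$) if $p(\sigma v)=\tau p(v)$ for all $v\in V$, where $\tau(x,y)=(-x,y)$. A flex of $(G,p)$ is a family $(p_t)_{t\in[0,1]}$ of realisations of $G$ with $p_0=p$, each $t\mapsto p_t(v)$ continuous, and each $\|p_t(u)-p_t(v)\|$, $uv\in E$, constant in $t$; it is trivial if it is the restriction to $p(V)$ of a rigid body motion of the plane (a continuous family of isometries starting at the identity). $(G,p)$ is reflection-symmetric flexible if it has a non-trivial flex such that every $(G,p_t)$ is reflection-symmetric with reflection $\sigma$. Colourings. A NAC-colouring of $G$ is a surjective map $E\to\{\text{red},\text{blue}\}$ such that each cycle is monochromatic or has at least two edges of each colour. A pseudo-RS-colouring is a map $\delta:E\to\{\text{red},\text{blue},\text{gold}\}$ that attains red and blue, becomes a NAC-colouring when gold is changed to blue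 and also when gold is changed to red, and satisfies $\delta(e)=\text{red}\iff\delta(\sigma e)=\text{blue}$ for all $e\in E$. It is an RS-colouring if for every cycle with exactly one gold edge there are edges $e_1,e_2$ of the cycle and a pseudo-RS-colouring $\delta'$ with $\delta(e_1)=\delta(e_2)$ and $\delta'(e_1)\neq\delta'(e_2)$ (in particular if there is no such cycle). It is Cartesian if there are no distinct vertices $v,w$ that are joined by three paths, one with red and blue edges only, one with red and gold edges only, and one with blue and gold edges only. Classes. An angle-preserving class is an equivalence class of the equivalence relation on $E$ generated by relating any two edges of a common 3-cycle and any two opposite edges of a 4-cycle. A ribbon is an equivalence class of the equivalence relation on $E$ generated by relating any two opposite edges of a 4-cycle only. A class $r$ is invariant if $\sigma r=r$. Frameworks. A parallelogram is non-degenerate if its vertices are not all collinear. $(G,p)$ is a TP-framework if $p$ is injective, each induced 4-cycle of $G$ forms a non-degenerate parallelogram in $p$, and the 2-dimensional complex obtained from $G$ by gluing a 2-cell along every 3-cycle and every induced 4-cycle is simply connected. $(H,p)$ is a P-framework if $H$ is connected, deleting the edges of any ribbon disconnects $H$, $p$ is injective, and each 4-cycle of $H$ forms a non-degenerate parallelogram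 in $p$. $(G,p)$ is a braced P-framework if $G$ arises from a graph $H$ on the same vertex set, with $(H,p)$ a P-framework, by adding some (possibly no) diagonals of 4-cycles of $H$. Corollary. Let $(G,p)$ be a TP-framework or a braced P-framework that is reflection-symmetric with reflection $\sigma$. Then the following are equivalent: (1) $(G,p)$ is reflection-symmetric flexible; (2) $G$ has a Cartesian RS-colouring (with respect to $\sigma$); (3) $G$ has a non-invariant angle-preserving class. -/

import Mathlib

namespace RSFramework

/-- The Euclidean plane. -/
abbrev Plane : Type := EuclideanSpace ℝ (Fin 2)

/-- The planar reflection in the `y`-axis, i.e. the linear map with matrix `diag(-1, 1)`. -/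
noncomputable def tau (x : Plane) : Plane := !₂[-(x 0), x 1]

section Frameworks

variable {V : Type*} (G : SimpleGraph V)

/-- `p` is a realisation of `G`: adjacent vertices are placed at distinct points. -/
def IsRealisation (p : V → Plane) : Prop :=
  ∀ ⦃u v : V⦄, G.Adj u v → p u ≠ p v

/-- A flex of the framework `(G, p)`, parametrised by `t ∈ [0, 1]`. -/
structure IsFlex (p : V → Plane) (P : unitInterval → V → Plane) : Prop where
  realisation : ∀ t, IsRealisation G (P t)
  continuous : ∀ v, Continuous fun t => P t v
  start : ∀ v, P 0 v = p v
  length_const : ∀ ⦃u v : V⦄, G.Adj u v → ∀ s t, ‖P s u - P s v‖ = ‖P t u - P t v‖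

/-- A family of realisations starting at `p` is trivial if it is the restriction to the points `p v`
of a rigid body motion, i.e. of a continuous family of isometries of the plane starting at the
identity. -/
def IsTrivialFlex (p : V → Plane) (P : unitInterval → V → Plane) : Prop :=
  ∃ g : unitInterval → (Plane ≃ᵃⁱ[ℝ] Plane),
    (∀ x, Continuous fun t => g t x) ∧ (∀ x, g 0 x = x) ∧ ∀ t v, P t v = g t (p v)

variable {G}

/-- A reflection of a graph: an automorphism of order exactly two. -/
def IsReflection (σ : G ≃g G) : Prop :=
  (∃ v, σ v ≠ v) ∧ ∀ v, σ (σ v) = v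

/-- The placement `p` is reflection-symmetric with reflection `σ`. -/
def IsReflectionSymmetric (σ : G ≃g G) (p : V → Plane) : Prop :=
  ∀ v, p (σ v) = tau (p v)

/-- `(G, p)` is reflection-symmetric flexible: there is a non-trivial flex all of whose members are
reflection-symmetric with reflection `σ`. -/
def IsRSFlexible (σ : G ≃g G) (p : V → Plane) : Prop :=
  ∃ P : unitInterval → V → Plane,
    IsFlex G p P ∧ (∀ t, IsReflectionSymmetric σ (P t)) ∧ ¬ IsTrivialFlex p P

end Frameworks

section Colourings

/-- The colours of a NAC-colouring. -/
inductive NACColour : Type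
  | red | blue

/-- The colours of an RS-colouring. -/
inductive RSColour : Type
  | red | blue | gold

/-- Changing gold to the colour `c`. -/
def RSColour.changeGold (c : NACColour) : RSColour → NACColour
  | .red => .red
  | .blue => .blue
  | .gold => c

variable {V : Type*} {G : SimpleGraph V}

/-- The set of edges of a walk which have colour `c`. -/
def colouredEdges {C : Type} (δ : G.edgeSet → C) {u v : V} (W : G.Walk u v) (c : C) :
    Set G.edgeSet :=
  {e | e.1 ∈ W.edges ∧ δ e = c}

/-- NAC-colourings: surjective, and each cycle is either monochromatic or has at least two edges of
each colour. -/
structure IsNACColouring (δ : G.edgeSet → NACColour) : Prop where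
  surjective : Function.Surjective δ
  cycle : ∀ (v : V) (W : G.Walk v v), W.IsCycle →
    (∃ c, ∀ e : G.edgeSet, e.1 ∈ W.edges → δ e = c) ∨ ∀ c, (colouredEdges δ W c).Nontrivial

/-- Pseudo-RS-colourings of the graph `G` with reflection `σ`. -/
structure IsPseudoRSColouring (σ : G ≃g G) (δ : G.edgeSet → RSColour) : Prop where
  exists_red : ∃ e, δ e = .red
  exists_blue : ∃ e, δ e = .blue
  gold_to_blue : IsNACColouring fun e => (δ e).changeGold .blue
  gold_to_red : IsNACColouring fun e => (δ e).changeGold .red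
  symm : ∀ e, δ e = .red ↔ δ (σ.mapEdgeSet e) = .blue

/-- A cycle is almost red-blue if it has exactly one gold edge. -/
def IsAlmostRedBlue (δ : G.edgeSet → RSColour) {v : V} (W : G.Walk v v) : Prop :=
  W.IsCycle ∧ ∃! e, e ∈ colouredEdges δ W .gold

/-- RS-colourings: pseudo-RS-colourings that have no almost red-blue cycle, or for which each almost
red-blue cycle has a certificate. -/
def IsRSColouring (σ : G ≃g G) (δ : G.edgeSet → RSColour) : Prop :=
  IsPseudoRSColouring σ δ ∧
    ((∀ (v : V) (W : G.Walk v v), ¬ IsAlmostRedBlue δ W) ∨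
      ∀ (v : V) (W : G.Walk v v), IsAlmostRedBlue δ W →
        ∃ e₁ e₂ : G.edgeSet, e₁.1 ∈ W.edges ∧ e₂.1 ∈ W.edges ∧
          ∃ δ' : G.edgeSet → RSColour, IsPseudoRSColouring σ δ' ∧ δ e₁ = δ e₂ ∧ δ' e₁ ≠ δ' e₂)

/-- All edges of the walk have colour `c₁` or `c₂`. -/
def UsesOnly (δ : G.edgeSet → RSColour) {u v : V} (W : G.Walk u v) (c₁ c₂ : RSColour) : Prop :=
  ∀ e : G.edgeSet, e.1 ∈ W.edges → δ e = c₁ ∨ δ e = c₂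

/-- The Cartesian condition: no two distinct vertices are joined simultaneously by a red-blue path,
a red-gold path and a blue-gold path. -/
def IsCartesian (δ : G.edgeSet → RSColour) : Prop :=
  ¬ ∃ v w : V, v ≠ w ∧ ∃ Prb Prg Pbg : G.Walk v w, Prb.IsPath ∧ Prg.IsPath ∧ Pbg.IsPath ∧
    UsesOnly δ Prb .red .blue ∧ UsesOnly δ Prg .red .gold ∧ UsesOnly δ Pbg .blue .gold

end Colourings

section Classes

variable {V : Type*} (G : SimpleGraph V)

/-- `(u, v, w)` is a 3-cycle subgraph of `G`. -/
def IsThreeCycle (u v w : V) : Prop :=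
  G.Adj u v ∧ G.Adj v w ∧ G.Adj w u

/-- `(u, v, w, x)` is a (not necessarily induced) 4-cycle subgraph of `G`. -/
def IsFourCycle (u v w x : V) : Prop :=
  G.Adj u v ∧ G.Adj v w ∧ G.Adj w x ∧ G.Adj x u ∧ u ≠ w ∧ v ≠ x

/-- `(u, v, w, x)` is an induced 4-cycle of `G`. -/
def IsInducedFourCycle (u v w x : V) : Prop :=
  IsFourCycle G u v w x ∧ ¬ G.Adj u w ∧ ¬ G.Adj v x

/-- Two edges are in relation `△` if they are in a common 3-cycle. -/
def TriangleRel (e f : G.edgeSet) : Prop :=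
  ∃ u v w, IsThreeCycle G u v w ∧
    e.1 ∈ ({s(u, v), s(v, w), s(w, u)} : Set (Sym2 V)) ∧
    f.1 ∈ ({s(u, v), s(v, w), s(w, u)} : Set (Sym2 V))

/-- Two edges are in relation `□` if they are opposite edges of a 4-cycle. -/
def SquareRel (e f : G.edgeSet) : Prop :=
  ∃ u v w x, IsFourCycle G u v w x ∧ e.1 = s(u, v) ∧ f.1 = s(w, x)

/-- Angle-preserving classes: the equivalence classes of the reflexive-transitive closure of the
(symmetric) relation `△ ∪ □`. -/
def IsAngleClass (r : Set G.edgeSet) : Prop :=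
  ∃ e, r = {f | Relation.ReflTransGen (fun a b => TriangleRel G a b ∨ SquareRel G a b) e f}

/-- Ribbons: the equivalence classes of the reflexive-transitive closure of the (symmetric)
relation `□`. -/
def IsRibbon (r : Set G.edgeSet) : Prop :=
  ∃ e, r = {f | Relation.ReflTransGen (SquareRel G) e f}

variable {G}

/-- `G` has an angle-preserving class that is not mapped to itself by `σ`. -/
def HasNonInvariantAngleClass (σ : G ≃g G) : Prop :=
  ∃ r, IsAngleClass G r ∧ σ.mapEdgeSet '' r ≠ r

end Classes

section TriangleParallelogram

variable {V : Type*} (G : SimpleGraph V)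

/-- The points `a, b, c, d` are, in this cyclic order, the vertices of a parallelogram that is
non-degenerate, i.e. whose vertices are not all collinear. -/
def IsParallelogram (a b c d : Plane) : Prop :=
  b - a = c - d ∧ ¬ Collinear ℝ ({a, b, c, d} : Set Plane)

/-- A graph is ribbon-cutting if it is connected and each ribbon is an edge cut. -/
def IsRibbonCutting : Prop :=
  G.Connected ∧ ∀ r, IsRibbon G r → ¬ (G.deleteEdges (Subtype.val '' r)).Connected

/-- P-frameworks: injective placements of ribbon-cutting graphs in which each 4-cycle forms a
non-degenerate parallelogram. -/
structure IsPFramework (p : V → Plane) : Prop where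
  ribbonCutting : IsRibbonCutting G
  injective : Function.Injective p
  parallelogram : ∀ ⦃u v w x : V⦄, IsFourCycle G u v w x →
    IsParallelogram (p u) (p v) (p w) (p x)

/-- Braced P-frameworks: `G` arises from the graph `H` of a P-framework by adding some (possibly no)
braces, i.e. diagonals of 4-cycles of `H`. -/
def IsBracedPFramework (p : V → Plane) : Prop :=
  ∃ H : SimpleGraph V, H ≤ G ∧ IsPFramework H p ∧
    ∀ ⦃u w : V⦄, G.Adj u w → ¬ H.Adj u w → ∃ v x, IsFourCycle H u v w x

variable {G} in
/-- Combinatorial (edge-path) homotopy, relative to endpoints, in the 2-dimensional complex with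
1-skeleton `G` whose 2-cells are glued along all 3-cycles and all induced 4-cycles of `G`. -/
inductive WalkHomotopic : ∀ {u v : V}, G.Walk u v → G.Walk u v → Prop
  | refl {u v : V} (W : G.Walk u v) : WalkHomotopic W W
  | symm {u v : V} {W W' : G.Walk u v} : WalkHomotopic W W' → WalkHomotopic W' W
  | trans {u v : V} {W W' W'' : G.Walk u v} :
      WalkHomotopic W W' → WalkHomotopic W' W'' → WalkHomotopic W W''
  | append {u v w : V} {W W' : G.Walk u v} {X X' : G.Walk v w} :
      WalkHomotopic W W' → WalkHomotopic X X' → WalkHomotopic (W.append X) (W'.append X')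
  | backtrack {u v : V} (h : G.Adj u v) :
      WalkHomotopic (.cons h (.cons h.symm .nil)) .nil
  | triangle {u v w : V} (h₁ : G.Adj u v) (h₂ : G.Adj v w) (h₃ : G.Adj w u) :
      WalkHomotopic (.cons h₁ (.cons h₂ (.cons h₃ .nil))) .nil
  | square {u v w x : V} (h₁ : G.Adj u v) (h₂ : G.Adj v w) (h₃ : G.Adj w x) (h₄ : G.Adj x u)
      (h : IsInducedFourCycle G u v w x) :
      WalkHomotopic (.cons h₁ (.cons h₂ (.cons h₃ (.cons h₄ .nil)))) .nil

/-- TP-frameworks: the placement is injective, each induced 4-cycle forms a non-degenerate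
parallelogram, and the complex obtained from `G` by filling in all triangles and parallelograms is
simply connected. -/
structure IsTPFramework (p : V → Plane) : Prop where
  injective : Function.Injective p
  parallelogram : ∀ ⦃u v w x : V⦄, IsInducedFourCycle G u v w x →
    IsParallelogram (p u) (p v) (p w) (p x)
  connected : G.Connected
  null_homotopic : ∀ (v : V) (W : G.Walk v v), WalkHomotopic W .nil

end TriangleParallelogram

end RSFramework

/-! Everything rests on potentials: each angle-preserving class `r` admits `f : V → Plane` that
changes along edges of `r` exactly as `p` does and is constant along all other edges. For
TP-frameworks `f` is a walk sum, well defined by simple connectivity; for braced P-frameworks it is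
a sum of potentials of ribbons, each of which cuts the graph into two sides. Both cases become an
`IsParallelogramComplex`.

Let `r` be a non-invariant class. Then `r` and its mirror image are disjoint, and each has a
potential. Rotating the edges of `r` by `ω` and those of `σ r` by `conj ω` is a symmetric
non-trivial flex (`isRSFlexible_of_potential`). Colouring `r` red, `σ r` blue and the rest gold is a
Cartesian RS-colouring, since the three colours have potentials with sum `p`
(`exists_isRSColouring`).

Conversely, a Cartesian pseudo-RS-colouring is constant on classes, whereas `σ` exchanges red and
blue. For a flex, triangles and parallelograms move so that all edges of a class turn by a common
factor as long as the flex is near `p`; symmetry conjugates this factor, so on an invariant class it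
is real, hence 1. An open-closed argument on the unit interval then makes the flex a translation
(`hasNonInvariantAngleClass_of_isRSFlexible`). -/

namespace RSFramework

open Relation

/-! ### Angle-preserving classes and their images under the reflection. -/

section AngleRelation

variable {V : Type*} {G : SimpleGraph V}

/-- The edge given by an adjacency. -/
def edge {u v : V} (h : G.Adj u v) : G.edgeSet := ⟨s(u, v), h⟩

@[simp]
theorem edge_val {u v : V} (h : G.Adj u v) : (edge h).1 = s(u, v) := rfl

theorem edge_symm {u v : V} (h : G.Adj u v) : edge h.symm = edge h :=
  Subtype.ext Sym2.eq_swap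

theorem exists_edge (e : G.edgeSet) : ∃ u v, ∃ h : G.Adj u v, e = edge h := by
  obtain ⟨e, he⟩ := e
  induction e with | _ u v => exact ⟨u, v, he, rfl⟩

theorem eq_edge {u v : V} {e : G.edgeSet} (he : e.1 = s(u, v)) (h : G.Adj u v) : e = (edge h) :=
  Subtype.ext he

/-- The relation on edges generated by the triangles of `G` and the opposite sides of the
quadrilaterals in `Q`. -/
def GenRel (G : SimpleGraph V) (Q : V → V → V → V → Prop) : G.edgeSet → G.edgeSet → Prop :=
  ReflTransGen fun a b =>
    TriangleRel G a b ∨ ∃ u v w x, Q u v w x ∧ a.1 = s(u, v) ∧ b.1 = s(w, x)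

/-- The equivalence relation whose classes are the angle-preserving classes. -/
def AngleRel (G : SimpleGraph V) : G.edgeSet → G.edgeSet → Prop :=
  ReflTransGen fun a b => TriangleRel G a b ∨ SquareRel G a b

theorem reflTransGen_symm {α : Type*} {r : α → α → Prop} (hr : ∀ a b, r a b → r b a) {a b : α}
    (h : ReflTransGen r a b) : ReflTransGen r b a :=
  have : Std.Symm r := ⟨hr⟩
  ReflTransGen.stdSymm.symm _ _ h

theorem TriangleRel.symm {a b : G.edgeSet} (h : TriangleRel G a b) : TriangleRel G b a := by
  obtain ⟨u, v, w, h, ha, hb⟩ := h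
  exact ⟨u, v, w, h, hb, ha⟩

theorem IsFourCycle.rotate {u v w x : V} (h : IsFourCycle G u v w x) : IsFourCycle G v w x u :=
  ⟨h.2.1, h.2.2.1, h.2.2.2.1, h.1, h.2.2.2.2.2, h.2.2.2.2.1.symm⟩

theorem IsInducedFourCycle.rotate {u v w x : V} (h : IsInducedFourCycle G u v w x) :
    IsInducedFourCycle G v w x u :=
  ⟨h.1.rotate, h.2.2, fun h' => h.2.1 h'.symm⟩

theorem SquareRel.symm {a b : G.edgeSet} (h : SquareRel G a b) : SquareRel G b a := by
  obtain ⟨u, v, w, x, h, ha, hb⟩ := h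
  exact ⟨w, x, u, v, h.rotate.rotate, hb, ha⟩

theorem AngleRel.symm {a b : G.edgeSet} (h : AngleRel G a b) : AngleRel G b a :=
  reflTransGen_symm (fun _ _ h => h.imp TriangleRel.symm SquareRel.symm) h

theorem mapEdgeSet_val (σ : G ≃g G) (e : G.edgeSet) : (σ.mapEdgeSet e).1 = e.1.map σ := rfl

theorem AngleRel.map (σ : G ≃g G) {a b : G.edgeSet} (h : AngleRel G a b) :
    AngleRel G (σ.mapEdgeSet a) (σ.mapEdgeSet b) := by
  refine ReflTransGen.lift σ.mapEdgeSet (fun a b hab => ?_) _ _ h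
  rcases hab with ⟨u, v, w, ⟨h₁, h₂, h₃⟩, ha, hb⟩ | ⟨u, v, w, x, ⟨h₁, h₂, h₃, h₄, h₅, h₆⟩, ha, hb⟩
  · refine Or.inl ⟨σ u, σ v, σ w, ⟨σ.map_adj_iff.2 h₁, σ.map_adj_iff.2 h₂, σ.map_adj_iff.2 h₃⟩,
      ?_, ?_⟩
    · rw [mapEdgeSet_val]; rcases ha with ha | ha | ha <;> rw [ha] <;> simp
    · rw [mapEdgeSet_val]; rcases hb with hb | hb | hb <;> rw [hb] <;> simp
  · refine Or.inr ⟨σ u, σ v, σ w, σ x, ⟨σ.map_adj_iff.2 h₁, σ.map_adj_iff.2 h₂,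
      σ.map_adj_iff.2 h₃, σ.map_adj_iff.2 h₄, fun h => h₅ (σ.injective h),
      fun h => h₆ (σ.injective h)⟩, ?_, ?_⟩ <;> simp [ha, hb]

theorem mapEdgeSet_mapEdgeSet {σ : G ≃g G} (hσ : IsReflection σ) (e : G.edgeSet) :
    σ.mapEdgeSet (σ.mapEdgeSet e) = e := by
  obtain ⟨e, he⟩ := e
  induction e with
  | _ u v => exact Subtype.ext (congr_arg₂ (fun a b => s(a, b)) (hσ.2 u) (hσ.2 v))

/-- The automorphism permutes the classes, so invariance of a class can be tested on one edge; that
`σ` is an involution gives the reverse inclusion. -/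
theorem hasNonInvariantAngleClass_iff {σ : G ≃g G} (hσ : IsReflection σ) :
    HasNonInvariantAngleClass σ ↔ ∃ e, ¬ AngleRel G e (σ.mapEdgeSet e) := by
  constructor
  · rintro ⟨_, ⟨e, rfl⟩, h⟩
    refine ⟨e, fun he => h ?_⟩
    ext f
    constructor
    · rintro ⟨g, hg, rfl⟩
      exact ReflTransGen.trans he (AngleRel.map σ hg)
    · exact fun hf => ⟨σ.mapEdgeSet f, ReflTransGen.trans he (AngleRel.map σ hf),
        mapEdgeSet_mapEdgeSet hσ f⟩
  · rintro ⟨e, he⟩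
    refine ⟨_, ⟨e, rfl⟩, fun h => he ?_⟩
    have : σ.mapEdgeSet e ∈ {f | AngleRel G e f} := by
      unfold AngleRel
      rw [← h]
      exact ⟨e, ReflTransGen.refl, rfl⟩
    exact this

end AngleRelation

/-! ### Potentials of edge sets. -/

section Potentials

variable {V : Type*} {G : SimpleGraph V} {E : Type*} [AddCommGroup E]

open Classical in
/-- `f` changes along the edges in `S` as `p` does, and is constant along all other edges. -/
def IsPotential (p : V → E) (S : G.edgeSet → Prop) (f : V → E) : Prop :=
  ∀ ⦃u v : V⦄ (h : G.Adj u v),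
    f v - f u = if S (edge h) then p v - p u else 0

theorem IsPotential.compl {p : V → E} {S : G.edgeSet → Prop} {f : V → E} (hf : IsPotential p S f) :
    IsPotential p (fun e => ¬ S e) (p - f) := by
  intro u v h
  have := hf h
  by_cases hS : S (edge h) <;> simp [hS] at this ⊢
  · rw [sub_sub_sub_comm, this, sub_self]
  · rw [sub_sub_sub_comm, this, sub_zero]

theorem IsPotential.union {p : V → E} {S T : G.edgeSet → Prop} {f g : V → E}
    (hf : IsPotential p S f) (hg : IsPotential p T g) (hST : ∀ e, S e → ¬ T e) :
    IsPotential p (fun e => S e ∨ T e) (f + g) := by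
  intro u v h
  have h₁ := hf h
  have h₂ := hg h
  simp only [Pi.add_apply, add_sub_add_comm, h₁, h₂]
  by_cases hS : S (edge h)
  · simp [hS, hST _ hS]
  · by_cases hT : T (edge h) <;> simp [hS, hT]

theorem IsPotential.eq_of_walk {p : V → E} {S : G.edgeSet → Prop} {f : V → E}
    (hf : IsPotential p S f) {u v : V} (W : G.Walk u v)
    (hW : ∀ e : G.edgeSet, e.1 ∈ W.edges → ¬ S e) : f u = f v := by
  induction W with
  | nil => rfl
  | @cons u v w h W ih =>
    rw [← ih fun e he => hW e (by simp [he])]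
    have := hf h
    rw [if_neg (hW _ (by simp))] at this
    exact (sub_eq_zero.1 this).symm

/-- A potential distinguishes the ends of a trail with exactly one edge in the given set. -/
theorem IsPotential.ne_of_walk {p : V → E} (hp : ∀ ⦃u v⦄, G.Adj u v → p u ≠ p v)
    {S : G.edgeSet → Prop} {f : V → E}
    (hf : IsPotential p S f) {u v : V} (W : G.Walk u v) (hd : W.edges.Nodup)
    (hW : ∃! e : G.edgeSet, e.1 ∈ W.edges ∧ S e) : f u ≠ f v := by
  induction W with
  | nil => simp at hW
  | @cons u v w h W ih =>
    obtain ⟨e, ⟨he, heS⟩, hu⟩ := hW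
    rw [SimpleGraph.Walk.edges_cons, List.nodup_cons] at hd
    have hfh := hf h
    by_cases hS : S (edge h)
    -- The first edge is the unique one in `S` and is not repeated, so `f` is constant along the
    -- rest of the walk.
    · have hev : f v = f w := hf.eq_of_walk W fun e' he' hS' => by
        have h₁ := hu e' ⟨by simp [he'], hS'⟩
        have h₂ := hu _ ⟨by simp, hS⟩
        exact hd.1 (by rwa [h₁.trans h₂.symm] at he')
      rw [if_pos hS] at hfh
      rw [← hev]
      intro huv
      rw [huv, sub_self] at hfh
      exact hp h (sub_eq_zero.1 hfh.symm).symm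
    · rw [if_neg hS] at hfh
      rw [← sub_eq_zero.1 hfh]
      refine ih hd.2 ⟨e, ⟨?_, heS⟩, fun e' he' => hu e' ⟨by simp [he'.1], he'.2⟩⟩
      rw [SimpleGraph.Walk.edges_cons, List.mem_cons] at he
      rcases he with he | he
      · exact absurd (show S (edge h) by rwa [← eq_edge he h]) hS
      · exact he

end Potentials

/-! ### Potentials of classes in TP-frameworks and braced P-frameworks. -/

section Complexes

variable {V : Type*} {G : SimpleGraph V}

/-- A placement together with a family `Q` of parallelograms such that the classes of the relation
generated by triangles and parallelograms have potentials. -/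
structure IsParallelogramComplex (G : SimpleGraph V) (p : V → Plane)
    (Q : V → V → V → V → Prop) : Prop where
  injective : Function.Injective p
  fourCycle : ∀ ⦃u v w x⦄, Q u v w x → IsFourCycle G u v w x
  parallelogram : ∀ ⦃u v w x⦄, Q u v w x → IsParallelogram (p u) (p v) (p w) (p x)
  potential : ∀ e, ∃ f, IsPotential p (GenRel G Q e) f

theorem GenRel.symm {Q : V → V → V → V → Prop} (hQ : ∀ ⦃u v w x⦄, Q u v w x → Q v w x u)
    {a b : G.edgeSet} (h : GenRel G Q a b) : GenRel G Q b a := by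
  refine reflTransGen_symm (fun a b h => h.imp TriangleRel.symm ?_) h
  rintro ⟨u, v, w, x, h, ha, hb⟩
  exact ⟨w, x, u, v, hQ (hQ h), hb, ha⟩

theorem genRel_triangle {Q : V → V → V → V → Prop} {u v w : V} (h₁ : G.Adj u v) (h₂ : G.Adj v w)
    (h₃ : G.Adj w u) {e f : G.edgeSet}
    (he : e.1 ∈ ({s(u, v), s(v, w), s(w, u)} : Set (Sym2 V)))
    (hf : f.1 ∈ ({s(u, v), s(v, w), s(w, u)} : Set (Sym2 V))) : GenRel G Q e f :=
  ReflTransGen.single (Or.inl ⟨u, v, w, ⟨h₁, h₂, h₃⟩, he, hf⟩)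

theorem genRel_triangle_iff {Q : V → V → V → V → Prop} {u v w : V} (h₁ : G.Adj u v)
    (h₂ : G.Adj v w) (h₃ : G.Adj w u) {e f g : G.edgeSet}
    (he : e.1 ∈ ({s(u, v), s(v, w), s(w, u)} : Set (Sym2 V)))
    (hf : f.1 ∈ ({s(u, v), s(v, w), s(w, u)} : Set (Sym2 V))) :
    GenRel G Q g e ↔ GenRel G Q g f :=
  ⟨fun h => h.trans (genRel_triangle h₁ h₂ h₃ he hf),
    fun h => h.trans (genRel_triangle h₁ h₂ h₃ hf he)⟩

theorem genRel_square_iff {Q : V → V → V → V → Prop} (hQ : ∀ ⦃u v w x⦄, Q u v w x → Q v w x u)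
    {u v w x : V} (h : Q u v w x) (h₁ : G.Adj u v) (h₃ : G.Adj w x) {g : G.edgeSet} :
    GenRel G Q g (edge h₁) ↔ GenRel G Q g (edge h₃) :=
  ⟨fun h' => h'.trans (ReflTransGen.single (Or.inr ⟨u, v, w, x, h, rfl, rfl⟩)),
    fun h' => h'.trans (ReflTransGen.single (Or.inr ⟨w, x, u, v, hQ (hQ h), rfl, rfl⟩))⟩

namespace IsParallelogramComplex

variable {p : V → Plane} {Q : V → V → V → V → Prop}

/-- The increments of the potential of the class of `uv` sum to zero around the 4-cycle. If `wx`
were outside the class, then, whichever of the other two edges belong to it, two distinct vertices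
would coincide under `p`. Hence 4-cycles outside `Q` do not enlarge the classes. -/
theorem genRel_of_isFourCycle (hp : IsParallelogramComplex G p Q) {u v w x : V}
    (h : IsFourCycle G u v w x) {e f : G.edgeSet} (he : e.1 = s(u, v)) (hf : f.1 = s(w, x)) :
    GenRel G Q e f := by
  obtain ⟨h₁, h₂, h₃, h₄, h₅, h₆⟩ := h
  obtain rfl : e = (edge h₁) := Subtype.ext he
  obtain rfl : f = (edge h₃) := Subtype.ext hf
  obtain ⟨f, hf⟩ := hp.potential (edge h₁)
  have e₁ := hf h₁
  have e₂ := hf h₂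
  have e₃ := hf h₃
  have e₄ := hf h₄
  have hsum : (f v - f u) + (f w - f v) + (f x - f w) + (f u - f x) = 0 := by abel
  rw [e₁, e₂, e₃, e₄, if_pos (show GenRel G Q _ _ from ReflTransGen.refl)] at hsum
  by_contra hn
  rw [if_neg hn] at hsum
  split_ifs at hsum
  · exact h₃.ne (hp.injective (sub_eq_zero.1 (by rw [← hsum]; abel)))
  · exact h₅ (hp.injective (sub_eq_zero.1 (by rw [← hsum]; abel)).symm)
  · exact h₆ (hp.injective (sub_eq_zero.1 (by rw [← hsum]; abel)))
  · exact h₁.ne (hp.injective (sub_eq_zero.1 (by rw [← hsum]; abel)).symm)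

theorem genRel_eq (hp : IsParallelogramComplex G p Q) : GenRel G Q = AngleRel G := by
  ext a b
  constructor
  · refine ReflTransGen.mono (fun a b h => Or.imp_right ?_ h) _ _
    rintro ⟨u, v, w, x, h, ha, hb⟩
    exact ⟨u, v, w, x, hp.fourCycle h, ha, hb⟩
  · intro h
    induction h with
    | refl => exact ReflTransGen.refl
    | tail _ h ih =>
      rcases h with h | ⟨u, v, w, x, h, ha, hb⟩
      · exact ReflTransGen.tail ih (Or.inl h)
      · exact ReflTransGen.trans ih (hp.genRel_of_isFourCycle h ha hb)

end IsParallelogramComplex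

open Classical in
/-- The sum of the edge vectors in `S` along a walk. -/
noncomputable def walkSum (p : V → Plane) (S : G.edgeSet → Prop) :
    ∀ {u v : V}, G.Walk u v → Plane
  | _, _, .nil => 0
  | u, _, .cons (v := v) h W =>
    (if S (edge h) then p v - p u else 0) + walkSum p S W

theorem walkSum_append (p : V → Plane) (S : G.edgeSet → Prop) {u v w : V} (W : G.Walk u v)
    (X : G.Walk v w) : walkSum p S (W.append X) = walkSum p S W + walkSum p S X := by
  induction W with
  | nil => simp [walkSum]
  | cons h W ih => simp [walkSum, ih, add_assoc]

/-- The sum vanishes around every 2-cell: the edges of a triangle lie all inside or all outside the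
class, and opposite sides of a parallelogram lie in it together and cancel. -/
theorem walkSum_eq_of_walkHomotopic {p : V → Plane}
    (hpar : ∀ ⦃u v w x : V⦄, IsInducedFourCycle G u v w x →
      IsParallelogram (p u) (p v) (p w) (p x)) (e : G.edgeSet) {u v : V} {W X : G.Walk u v}
    (h : WalkHomotopic W X) :
    walkSum p (GenRel G (IsInducedFourCycle G) e) W =
      walkSum p (GenRel G (IsInducedFourCycle G) e) X := by
  induction h with
  | refl => rfl
  | symm _ ih => exact ih.symm
  | trans _ _ ih₁ ih₂ => exact ih₁.trans ih₂
  | append _ _ ih₁ ih₂ => rw [walkSum_append, walkSum_append, ih₁, ih₂]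
  | @backtrack u v h =>
    have := edge_symm h
    simp only [walkSum]
    rw [this]
    split_ifs <;> abel
  | @triangle u v w h₁ h₂ h₃ =>
    simp only [walkSum]
    rw [genRel_triangle_iff h₁ h₂ h₃ (e := (edge h₂)) (f := (edge h₁)) (by simp) (by simp),
      genRel_triangle_iff h₁ h₂ h₃ (e := (edge h₃)) (f := (edge h₁)) (by simp) (by simp)]
    split_ifs <;> abel
  | @square u v w x h₁ h₂ h₃ h₄ h =>
    have hQ := fun u v w x => IsInducedFourCycle.rotate (G := G) (u := u) (v := v) (w := w) (x := x)
    have hpq : p v - p u = p w - p x := (hpar h).1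
    have hpr : p w - p v = p x - p u := by rw [sub_eq_sub_iff_add_eq_add] at hpq ⊢; rw [← hpq]; abel
    simp only [walkSum]
    rw [genRel_square_iff hQ h h₁ h₃, genRel_square_iff hQ h.rotate h₂ h₄, hpq, hpr]
    split_ifs <;> abel

theorem IsTPFramework.isParallelogramComplex {p : V → Plane} (hp : IsTPFramework G p) :
    IsParallelogramComplex G p (IsInducedFourCycle G) where
  injective := hp.injective
  fourCycle _ _ _ _ h := h.1
  parallelogram := hp.parallelogram
  potential e := by
    have : Nonempty V := hp.connected.nonempty
    let v₀ : V := Classical.arbitrary V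
    let W : ∀ v, G.Walk v₀ v := fun v => (hp.connected.preconnected v₀ v).some
    have hclosed : ∀ (v : V) (X : G.Walk v v),
        walkSum p (GenRel G (IsInducedFourCycle G) e) X = 0 := fun v X => by
      rw [walkSum_eq_of_walkHomotopic hp.parallelogram e (hp.null_homotopic v X)]
      rfl
    refine ⟨fun v => walkSum p (GenRel G (IsInducedFourCycle G) e) (W v), ?_⟩
    intro u v h
    have h₁ := hclosed _ ((W u).append (.cons h (W v).reverse))
    have h₂ := hclosed _ ((W v).append (W v).reverse)
    rw [walkSum_append] at h₁ h₂
    rw [walkSum] at h₁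
    beta_reduce
    rw [eq_neg_of_add_eq_zero_left h₂]
    refine sub_eq_zero.1 (Eq.trans ?_ ((congrArg Neg.neg h₁).trans neg_zero))
    abel

/-- Otherwise all four vertices lie on the line through `a` in direction `b - a`. -/
theorem not_parallel_of_isParallelogram {a b c d : Plane} (h : IsParallelogram a b c d) (k : ℝ) :
    d - a ≠ k • (b - a) := by
  intro hk
  refine h.2 ((collinear_iff_of_mem (p₀ := a) (by simp)).2 ⟨b - a, ?_⟩)
  have hc : c = d - a + (b - a) + a := by rw [h.1]; abel
  rintro x (rfl | rfl | rfl | rfl)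
  · exact ⟨0, by simp⟩
  · exact ⟨1, by simp⟩
  · exact ⟨k + 1, by rw [hc, hk, add_smul, one_smul, vadd_eq_add]⟩
  · exact ⟨k, by rw [← hk]; simp⟩

/-- All edges of a ribbon are translates of `ab` and, suitably oriented, lead from the component of
`a` to that of `b` once the ribbon is deleted. As the ribbon is a cut, these components differ, and
a function with value zero on the first and `p b - p a` elsewhere is a potential. -/
theorem IsPFramework.exists_potential {H : SimpleGraph V} {p : V → Plane} (hp : IsPFramework H p)
    (e : H.edgeSet) : ∃ f, IsPotential p (ReflTransGen (SquareRel H) e) f := by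
  classical
  obtain ⟨a, b, he, rfl⟩ := exists_edge e
  set r : Set H.edgeSet := {e' | ReflTransGen (SquareRel H) (edge he) e'} with hr
  set D := H.deleteEdges (Subtype.val '' r) with hD
  have hpar : ∀ f ∈ r, ∃ c d, f.1 = s(c, d) ∧ p d - p c = p b - p a := by
    intro f hf
    induction hf with
    | refl => exact ⟨a, b, rfl, rfl⟩
    | tail _ h ih =>
      obtain ⟨c, d, hcd, hpcd⟩ := ih
      obtain ⟨u, v, w, x, h, hu, hw⟩ := h
      have := (hp.parallelogram h).1
      rw [hcd, Sym2.eq_iff] at hu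
      rcases hu with ⟨rfl, rfl⟩ | ⟨rfl, rfl⟩
      · exact ⟨x, w, hw.trans Sym2.eq_swap, by rw [← this, hpcd]⟩
      · exact ⟨w, x, hw, by rw [← hpcd, ← neg_inj, neg_sub, neg_sub, this]⟩
  -- A side next to a ribbon edge in a 4-cycle is not parallel to it, so it survives the deletion
  -- and keeps the ends of opposite edges in the same component.
  have hside : ∀ ⦃u v w x⦄ (huv : H.Adj u v), IsFourCycle H u v w x → edge huv ∈ r →
      D.Adj u x := by
    intro u v w x h' h huv
    rw [hD, SimpleGraph.deleteEdges_adj]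
    refine ⟨h.2.2.2.1.symm, ?_⟩
    rintro ⟨f, hf, hfu⟩
    obtain ⟨c, d, hcd, hpcd⟩ := hpar f hf
    obtain ⟨c', d', hcd', hpcd'⟩ := hpar _ huv
    have hn := not_parallel_of_isParallelogram (hp.parallelogram h)
    have h₁ := hn 1
    have h₂ := hn (-1)
    rw [hcd, Sym2.eq_iff] at hfu
    rw [edge_val, Sym2.eq_iff] at hcd'
    rw [one_smul] at h₁
    rw [neg_smul, one_smul, neg_sub] at h₂
    rcases hfu with ⟨rfl, rfl⟩ | ⟨rfl, rfl⟩ <;> rcases hcd' with ⟨rfl, rfl⟩ | ⟨rfl, rfl⟩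
    · exact h₁ (hpcd.trans hpcd'.symm)
    · exact h₂ (hpcd.trans hpcd'.symm)
    · exact h₂ (by rw [← neg_inj, neg_sub, neg_sub, hpcd, hpcd'])
    · exact h₁ (by rw [← neg_inj, neg_sub, neg_sub, hpcd, hpcd'])
  have hor : ∀ f ∈ r, ∃ c d, f.1 = s(c, d) ∧ p d - p c = p b - p a ∧ D.Reachable a c ∧
      D.Reachable b d := by
    intro f hf
    induction hf with
    | refl => exact ⟨a, b, rfl, rfl, .rfl, .rfl⟩
    | @tail f g hf h ih =>
      obtain ⟨c, d, hcd, hpcd, hac, hbd⟩ := ih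
      obtain ⟨u, v, w, x, h, hu, hw⟩ := h
      have hpq := (hp.parallelogram h).1
      obtain rfl : f = (edge (h.1)) := Subtype.ext hu
      have hux : D.Adj u x := hside _ h hf
      have hvw : D.Adj v w := by
        refine hside (u := v) (v := u) (w := x) (x := w) h.1.symm ?_ ?_
        · obtain ⟨h₁, h₂, h₃, h₄, h₅, h₆⟩ := h
          exact ⟨h₁.symm, h₄.symm, h₃.symm, h₂.symm, h₆, h₅⟩
        · rw [edge_symm]
          exact hf
      rw [edge_val, Sym2.eq_iff] at hcd
      rcases hcd with ⟨rfl, rfl⟩ | ⟨rfl, rfl⟩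
      · exact ⟨x, w, hw.trans Sym2.eq_swap, by rw [← hpq, hpcd], hac.trans hux.reachable,
          hbd.trans hvw.reachable⟩
      · exact ⟨w, x, hw, by rw [← hpcd, ← neg_inj, neg_sub, neg_sub, hpq],
          hac.trans hvw.reachable, hbd.trans hux.reachable⟩
  have hadj : ∀ ⦃u v⦄ (h : H.Adj u v), (edge h) ∉ r → D.Adj u v := by
    intro u v h hn
    rw [hD, SimpleGraph.deleteEdges_adj]
    refine ⟨h, ?_⟩
    rintro ⟨f, hf, hfu⟩
    exact hn (by rwa [← show f = (edge h) from Subtype.ext hfu])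
  -- If `a` and `b` were still joined, so would be the ends of every deleted edge, and the deletion
  -- would not disconnect `H`.
  have hcut : ¬ D.Reachable a b := by
    intro hab
    refine hp.ribbonCutting.2 r ⟨(edge he), rfl⟩ ?_
    have hall : ∀ ⦃u v⦄, H.Adj u v → D.Reachable u v := by
      intro u v h
      by_cases huv : (edge h) ∈ r
      · obtain ⟨c, d, hcd, -, hac, hbd⟩ := hor _ huv
        have hcd' : D.Reachable c d := hac.symm.trans (hab.trans hbd)
        rw [edge_val, Sym2.eq_iff] at hcd
        rcases hcd with ⟨rfl, rfl⟩ | ⟨rfl, rfl⟩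
        exacts [hcd', hcd'.symm]
      · exact (hadj h huv).reachable
    have := hp.ribbonCutting.1.nonempty
    refine ⟨fun u v => ?_⟩
    obtain ⟨W⟩ := hp.ribbonCutting.1.preconnected u v
    induction W with
    | nil => exact .rfl
    | cons h _ ih => exact (hall h).trans ih
  refine ⟨fun v => if D.Reachable a v then 0 else p b - p a, fun u v h => ?_⟩
  by_cases huv : (edge h) ∈ r
  · rw [if_pos (show ReflTransGen _ _ _ from huv)]
    obtain ⟨c, d, hcd, hpcd, hac, hbd⟩ := hor _ huv
    have had : ¬ D.Reachable a d := fun had => hcut (had.trans hbd.symm)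
    rw [edge_val, Sym2.eq_iff] at hcd
    rcases hcd with ⟨rfl, rfl⟩ | ⟨rfl, rfl⟩
    · simp [hac, had, hpcd]
    · simp only [hac, had, if_true, if_false]
      rw [← hpcd]; abel
  · rw [if_neg (show ¬ ReflTransGen _ _ _ from huv)]
    have : D.Reachable a u ↔ D.Reachable a v :=
      ⟨fun h' => h'.trans (hadj h huv).reachable, fun h' => h'.trans (hadj h huv).symm.reachable⟩
    simp [this]

/-- The edges of `H` in a class of `G` form a union of ribbons of `H`, so the potentials of these
ribbons can be added up. The braces then follow from the triangles that they form with two edges of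
`H`. -/
theorem IsBracedPFramework.isParallelogramComplex [Finite V] {p : V → Plane}
    (hp : IsBracedPFramework G p) : ∃ Q, IsParallelogramComplex G p Q := by
  classical
  obtain ⟨H, hHG, hp, hb⟩ := hp
  have hmono : ∀ ⦃u v w x⦄, IsFourCycle H u v w x → IsFourCycle G u v w x :=
    fun u v w x h => ⟨hHG h.1, hHG h.2.1, hHG h.2.2.1, hHG h.2.2.2.1, h.2.2.2.2⟩
  refine ⟨IsFourCycle H, hp.injective, hmono, hp.parallelogram, fun e => ?_⟩
  let S : Setoid H.edgeSet := ⟨ReflTransGen (SquareRel H), fun _ => ReflTransGen.refl,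
    fun h => reflTransGen_symm (fun _ _ => SquareRel.symm) h, fun h h' => h.trans h'⟩
  have : Fintype (Quotient S) := Fintype.ofFinite _
  choose F hF using hp.exists_potential
  let ι : H.edgeSet → G.edgeSet := fun f => ⟨f.1, SimpleGraph.edgeSet_mono hHG f.2⟩
  have hι : ∀ ⦃f g⦄, ReflTransGen (SquareRel H) f g → GenRel G (IsFourCycle H) (ι f) (ι g) := by
    refine fun f g h => ReflTransGen.lift ι (fun a b hab => Or.inr ?_) _ _ h
    obtain ⟨u, v, w, x, h, ha, hb⟩ := hab
    exact ⟨u, v, w, x, h, ha, hb⟩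
  let f : V → Plane := fun v =>
    ∑ r : Quotient S, if GenRel G (IsFourCycle H) e (ι r.out) then F r.out v else 0
  have hfH : ∀ ⦃u v⦄ (h : H.Adj u v), f v - f u =
      if GenRel G (IsFourCycle H) e (edge (hHG h)) then p v - p u else 0 := by
    intro u v h
    have hout : ReflTransGen (SquareRel H) (Quotient.mk S (edge h)).out (edge h) :=
      Quotient.mk_out (s := S) (edge h)
    simp only [f]
    -- Only the potential of the ribbon through `uv` changes along this edge.
    rw [← Finset.sum_sub_distrib, Finset.sum_eq_single (Quotient.mk S (edge h))]
    · have h₁ := hF (Quotient.mk S (edge h)).out h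
      rw [if_pos hout] at h₁
      have h₂ : GenRel G (IsFourCycle H) e (ι (Quotient.mk S (edge h)).out) ↔
          GenRel G (IsFourCycle H) e (edge (hHG h)) :=
        ⟨fun h' => h'.trans (hι hout), fun h' => h'.trans (hι (S.symm hout))⟩
      simp only [h₂]
      split_ifs
      · exact h₁
      · simp
    · intro r _ hr
      have h₁ := hF r.out h
      rw [if_neg] at h₁
      · split_ifs
        · exact h₁
        · simp
      · intro h'
        exact hr (by rw [← Quotient.out_eq r]; exact Quotient.sound (s := S) h')
    · simp
  refine ⟨f, fun u w h => ?_⟩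
  by_cases hH : H.Adj u w
  · exact hfH hH
  · obtain ⟨v, x, hc⟩ := hb h hH
    have hc' := hmono hc
    have h₁ := hfH hc.1
    have h₂ := hfH hc.2.1
    rw [genRel_triangle_iff hc'.1 hc'.2.1 h.symm (f := (edge h)) (by simp)
      (by simp [Sym2.eq_swap])] at h₁ h₂
    rw [← sub_add_sub_cancel (f w) (f v) (f u), h₁, h₂]
    split_ifs <;> abel

end Complexes

/-! ### NAC-colourings, and Cartesian colourings on classes. -/

section Colourings

variable {V : Type*} {G : SimpleGraph V}

theorem NACColour.eq_of_ne {a b c : NACColour} (ha : a ≠ c) (hb : b ≠ c) : a = b := by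
  cases a <;> cases b <;> cases c <;> simp_all

/-- A potential for one colour gives one for the other by subtraction from `p`; a cycle with exactly
one edge of a colour would then have `f v ≠ f v`. -/
theorem IsNACColouring.of_isPotential {E : Type*} [AddCommGroup E] {p : V → E}
    (hp : ∀ ⦃u v⦄, G.Adj u v → p u ≠ p v)
    {δ : G.edgeSet → NACColour} (hδ : Function.Surjective δ) {c : NACColour} {f : V → E}
    (hf : IsPotential p (fun e => δ e = c) f) : IsNACColouring δ where
  surjective := hδ
  cycle v W hW := by
    refine or_iff_not_imp_left.2 fun hm d => ?_
    have hpot : ∃ g, IsPotential p (fun e => δ e = d) g := by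
      by_cases hd : d = c
      · exact ⟨f, hd ▸ hf⟩
      · refine ⟨p - f, ?_⟩
        convert hf.compl using 2 with e
        exact ⟨fun h => h ▸ hd, fun h => NACColour.eq_of_ne h hd⟩
    obtain ⟨g, hg⟩ := hpot
    by_contra hn
    rw [Set.not_nontrivial_iff] at hn
    have hex : ∃ e : G.edgeSet, e.1 ∈ W.edges ∧ δ e = d := by
      by_contra! hno
      obtain ⟨c', hc'⟩ : ∃ c', c' ≠ d := by cases d <;> [exact ⟨.blue, by simp⟩; exact ⟨.red, by simp⟩]
      exact hm ⟨c', fun e he => NACColour.eq_of_ne (hno e he) hc'⟩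
    obtain ⟨e, he⟩ := hex
    exact hg.ne_of_walk hp W hW.edges_nodup ⟨e, he, fun e' he' => hn he' he⟩ rfl

/-- Every edge of a cycle shares its colour with another edge of the cycle. -/
theorem IsNACColouring.exists_eq {δ : G.edgeSet → NACColour} (hδ : IsNACColouring δ) {v : V}
    {W : G.Walk v v} (hW : W.IsCycle) {e : G.edgeSet} (he : e.1 ∈ W.edges) :
    ∃ e' : G.edgeSet, e'.1 ∈ W.edges ∧ e' ≠ e ∧ δ e' = δ e := by
  rcases hδ.cycle v W hW with ⟨c, hc⟩ | h
  · by_contra! hno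
    have hall : ∀ e' ∈ W.edges, e' = e.1 := fun e' he' => by
      by_contra hne
      exact hno ⟨e', W.edges_subset_edgeSet he'⟩ he' (fun h => hne (congrArg Subtype.val h))
        ((hc _ he').trans (hc _ he).symm)
    have h₁ := hW.edges_nodup
    rw [List.eq_replicate_of_mem hall, List.nodup_replicate] at h₁
    have := hW.three_le_length
    rw [← W.length_edges] at this
    omega
  · obtain ⟨e', ⟨he', hc⟩, hne⟩ := (h (δ e)).exists_ne e
    exact ⟨e', he', hne, hc⟩

theorem IsNACColouring.triangle {δ : G.edgeSet → NACColour} (hδ : IsNACColouring δ) {u v w : V}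
    (h₁ : G.Adj u v) (h₂ : G.Adj v w) (h₃ : G.Adj w u) :
    δ (edge h₁) = δ (edge h₂) ∧ δ (edge h₁) = δ (edge h₃) := by
  have hW : (SimpleGraph.Walk.cons h₁ (.cons h₂ (.cons h₃ .nil))).IsCycle := by
    rw [SimpleGraph.Walk.cons_isCycle_iff]
    simp [h₁.ne, h₂.ne, h₃.ne, h₁.ne', h₃.ne']
  have hmem : ∀ e : G.edgeSet,
      e.1 ∈ (SimpleGraph.Walk.cons h₁ (.cons h₂ (.cons h₃ .nil))).edges →
      e = edge h₁ ∨ e = edge h₂ ∨ e = edge h₃ := fun e he => by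
    simpa [Subtype.ext_iff] using he
  obtain ⟨e₁, m₁, n₁, c₁⟩ := hδ.exists_eq hW (e := edge h₁) (by simp)
  obtain ⟨e₂, m₂, n₂, c₂⟩ := hδ.exists_eq hW (e := edge h₂) (by simp)
  obtain ⟨e₃, m₃, n₃, c₃⟩ := hδ.exists_eq hW (e := edge h₃) (by simp)
  rcases hmem _ m₁ with rfl | rfl | rfl <;> rcases hmem _ m₂ with rfl | rfl | rfl <;>
    rcases hmem _ m₃ with rfl | rfl | rfl <;> grind

theorem IsNACColouring.fourCycle {δ : G.edgeSet → NACColour} (hδ : IsNACColouring δ)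
    {u v w x : V} (h₁ : G.Adj u v) (h₂ : G.Adj v w) (h₃ : G.Adj w x) (h₄ : G.Adj x u)
    (huw : u ≠ w) (hvx : v ≠ x) :
    (δ (edge h₁) = δ (edge h₂) ∧ δ (edge h₃) = δ (edge h₄)) ∨
    (δ (edge h₁) = δ (edge h₃) ∧ δ (edge h₂) = δ (edge h₄)) ∨
    (δ (edge h₁) = δ (edge h₄) ∧ δ (edge h₂) = δ (edge h₃)) := by
  have hW : (SimpleGraph.Walk.cons h₁ (.cons h₂ (.cons h₃ (.cons h₄ .nil)))).IsCycle := by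
    rw [SimpleGraph.Walk.cons_isCycle_iff]
    simp [h₁.ne, h₂.ne, h₃.ne, h₄.ne, h₁.ne', h₄.ne', huw, huw.symm, hvx]
  have hmem : ∀ e : G.edgeSet,
      e.1 ∈ (SimpleGraph.Walk.cons h₁ (.cons h₂ (.cons h₃ (.cons h₄ .nil)))).edges →
      e = edge h₁ ∨ e = edge h₂ ∨ e = edge h₃ ∨ e = edge h₄ := fun e he => by
    simpa [Subtype.ext_iff] using he
  have key : ∀ e e' : G.edgeSet, e' ≠ e → δ e' = δ e →
      (e' = edge h₁ ∨ e' = edge h₂ ∨ e' = edge h₃ ∨ e' = edge h₄) →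
      (e ≠ edge h₁ ∧ δ e = δ (edge h₁)) ∨ (e ≠ edge h₂ ∧ δ e = δ (edge h₂)) ∨
      (e ≠ edge h₃ ∧ δ e = δ (edge h₃)) ∨ (e ≠ edge h₄ ∧ δ e = δ (edge h₄)) := by
    rintro e e' hne hc (rfl | rfl | rfl | rfl)
    · exact Or.inl ⟨hne.symm, hc.symm⟩
    · exact Or.inr (Or.inl ⟨hne.symm, hc.symm⟩)
    · exact Or.inr (Or.inr (Or.inl ⟨hne.symm, hc.symm⟩))
    · exact Or.inr (Or.inr (Or.inr ⟨hne.symm, hc.symm⟩))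
  have other : ∀ e : G.edgeSet,
      e.1 ∈ (SimpleGraph.Walk.cons h₁ (.cons h₂ (.cons h₃ (.cons h₄ .nil)))).edges →
      (e ≠ edge h₁ ∧ δ e = δ (edge h₁)) ∨ (e ≠ edge h₂ ∧ δ e = δ (edge h₂)) ∨
      (e ≠ edge h₃ ∧ δ e = δ (edge h₃)) ∨ (e ≠ edge h₄ ∧ δ e = δ (edge h₄)) := fun e he => by
    obtain ⟨e', m, n, c⟩ := hδ.exists_eq hW he
    exact key e e' n c (hmem _ m)
  have o₁ := other (edge h₁) (by simp)
  have o₂ := other (edge h₂) (by simp)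
  have o₃ := other (edge h₃) (by simp)
  have o₄ := other (edge h₄) (by simp)
  simp only [ne_eq, not_true_eq_false, false_and, false_or, or_false] at o₁ o₂ o₃ o₄
  generalize δ (edge h₁) = a at *
  generalize δ (edge h₂) = b at *
  generalize δ (edge h₃) = c at *
  generalize δ (edge h₄) = d at *
  clear hmem key other
  cases a <;> cases b <;> cases c <;> cases d <;> simp_all

theorem RSColour.eq_of_changeGold {a b : RSColour}
    (h₁ : a.changeGold .blue = b.changeGold .blue) (h₂ : a.changeGold .red = b.changeGold .red) :
    a = b := by
  cases a <;> cases b <;> simp_all [RSColour.changeGold]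

theorem RSColour.opposite_or_adjacent {a b c d : RSColour}
    (hb : (a.changeGold .blue = b.changeGold .blue ∧ c.changeGold .blue = d.changeGold .blue) ∨
      (a.changeGold .blue = c.changeGold .blue ∧ b.changeGold .blue = d.changeGold .blue) ∨
      (a.changeGold .blue = d.changeGold .blue ∧ b.changeGold .blue = c.changeGold .blue))
    (hr : (a.changeGold .red = b.changeGold .red ∧ c.changeGold .red = d.changeGold .red) ∨
      (a.changeGold .red = c.changeGold .red ∧ b.changeGold .red = d.changeGold .red) ∨
      (a.changeGold .red = d.changeGold .red ∧ b.changeGold .red = c.changeGold .red)) :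
    a = c ∨ (a = b ∧ c = d) ∨ (a = d ∧ b = c) := by
  cases a <;> cases b <;> cases c <;> cases d <;> simp_all [RSColour.changeGold]

/-- Two 2-element subsets of a 3-element set meet. -/
theorem RSColour.eq_or_of_ne {a b c d : RSColour} (hab : a ≠ b) (hcd : c ≠ d) :
    (a = c ∨ a = d) ∨ (b = c ∨ b = d) := by
  cases a <;> cases b <;> cases c <;> cases d <;> simp_all

/-- If the monochromatic paths `u v w` and `u x w` had different colours, every pair of colours
would contain one of these two, so the two paths would supply all three forbidden paths from `u` to
`w`. -/
theorem IsCartesian.eq_of_fourCycle {δ : G.edgeSet → RSColour} (hδ : IsCartesian δ)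
    {u v w x : V} (h₁ : G.Adj u v) (h₂ : G.Adj v w) (h₃ : G.Adj w x) (h₄ : G.Adj x u)
    (huw : u ≠ w) (h₁₂ : δ (edge h₁) = δ (edge h₂)) (h₃₄ : δ (edge h₃) = δ (edge h₄)) :
    δ (edge h₁) = δ (edge h₃) := by
  by_contra hne
  have key : ∀ c d : RSColour, c ≠ d → ∃ W : G.Walk u w, W.IsPath ∧ UsesOnly δ W c d := by
    intro c d hcd
    rcases RSColour.eq_or_of_ne hne hcd with h | h
    · refine ⟨.cons h₁ (.cons h₂ .nil), by simp [h₁.ne, h₂.ne, huw], fun e he => ?_⟩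
      obtain rfl | rfl : e = edge h₁ ∨ e = edge h₂ := by simpa [Subtype.ext_iff] using he
      · exact h
      · rwa [← h₁₂]
    · refine ⟨.cons h₄.symm (.cons h₃.symm .nil), by simp [h₄.ne', h₃.ne', huw], fun e he => ?_⟩
      obtain rfl | rfl : e = edge h₄.symm ∨ e = edge h₃.symm := by
        simpa [Subtype.ext_iff] using he
      · rwa [edge_symm h₄, ← h₃₄]
      · rwa [edge_symm h₃]
  obtain ⟨P₁, p₁, u₁⟩ := key .red .blue (by simp)
  obtain ⟨P₂, p₂, u₂⟩ := key .red .gold (by simp)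
  obtain ⟨P₃, p₃, u₃⟩ := key .blue .gold (by simp)
  exact hδ ⟨u, w, huw, P₁, P₂, P₃, p₁, p₂, p₃, u₁, u₂, u₃⟩

/-- A Cartesian pseudo-RS-colouring is constant on angle-preserving classes. -/
theorem IsPseudoRSColouring.eq_of_angleRel {σ : G ≃g G} {δ : G.edgeSet → RSColour}
    (hδ : IsPseudoRSColouring σ δ) (hc : IsCartesian δ) {e f : G.edgeSet} (h : AngleRel G e f) :
    δ e = δ f := by
  induction h with
  | refl => rfl
  | @tail f g _ h ih =>
    rw [ih]
    rcases h with ⟨u, v, w, ⟨h₁, h₂, h₃⟩, hf, hg⟩ | ⟨u, v, w, x, ⟨h₁, h₂, h₃, h₄, h₅, h₆⟩, hf, hg⟩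
    · have hb := hδ.gold_to_blue.triangle h₁ h₂ h₃
      have hr := hδ.gold_to_red.triangle h₁ h₂ h₃
      have h₁₂ := RSColour.eq_of_changeGold hb.1 hr.1
      have h₁₃ := RSColour.eq_of_changeGold hb.2 hr.2
      have key : ∀ e : G.edgeSet, e.1 ∈ ({s(u, v), s(v, w), s(w, u)} : Set (Sym2 V)) →
          δ e = δ (edge h₁) := by
        rintro e (he | he | he)
        · rw [eq_edge he h₁]
        · rw [eq_edge he h₂, h₁₂]
        · rw [eq_edge he h₃, h₁₃]
      rw [key f hf, key g hg]
    · rw [eq_edge hf h₁, eq_edge hg h₃]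
      by_contra hne
      have hb := hδ.gold_to_blue.fourCycle h₁ h₂ h₃ h₄ h₅ h₆
      have hr := hδ.gold_to_red.fourCycle h₁ h₂ h₃ h₄ h₅ h₆
      rcases RSColour.opposite_or_adjacent hb hr with h | ⟨h₁₂, h₃₄⟩ | ⟨h₁₄, h₂₃⟩
      · exact hne h
      · exact hne (hc.eq_of_fourCycle h₁ h₂ h₃ h₄ h₅ h₁₂ h₃₄)
      · exact hne (h₂₃ ▸ h₁₄.trans ((hc.eq_of_fourCycle h₂ h₃ h₄ h₁ h₆ h₂₃ h₁₄.symm).symm))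

theorem hasNonInvariantAngleClass_of_isRSColouring {σ : G ≃g G} (hσ : IsReflection σ)
    {δ : G.edgeSet → RSColour} (hδ : IsRSColouring σ δ) (hc : IsCartesian δ) :
    HasNonInvariantAngleClass σ := by
  obtain ⟨e, he⟩ := hδ.1.exists_red
  refine (hasNonInvariantAngleClass_iff hσ).2 ⟨e, fun h => ?_⟩
  have h₁ := hδ.1.eq_of_angleRel hc h
  rw [he, (hδ.1.symm e).1 he] at h₁
  cases h₁

end Colourings

section Tau

theorem tau_sub (x y : Plane) : tau (x - y) = tau x - tau y := by
  ext i
  fin_cases i <;> simp [tau]; ring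

theorem tau_zero : tau 0 = 0 := by
  ext i
  fin_cases i <;> simp [tau]

theorem tau_tau (x : Plane) : tau (tau x) = x := by
  ext i
  fin_cases i <;> simp [tau]

end Tau

/-! ### The colouring induced by a non-invariant class. -/

section ExistsColouring

variable {V : Type*} {G : SimpleGraph V} {σ : G ≃g G} {p : V → Plane}

theorem IsPotential.reflect (hsymm : IsReflectionSymmetric σ p) {S : G.edgeSet → Prop}
    {f : V → Plane} (hf : IsPotential p S f) :
    IsPotential p (fun e => S (σ.mapEdgeSet e)) (fun v => tau (f (σ v))) := by
  intro u v h
  have := hf (σ.map_adj_iff.2 h)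
  rw [← tau_sub, this]
  by_cases hS : S (edge (σ.map_adj_iff.2 h))
  · refine Eq.trans ?_ (if_pos (c := S (σ.mapEdgeSet (edge h))) hS).symm
    rw [if_pos hS, tau_sub, hsymm, hsymm, tau_tau, tau_tau]
  · refine Eq.trans ?_ (if_neg (c := S (σ.mapEdgeSet (edge h))) hS).symm
    rw [if_neg hS, tau_zero]

theorem not_angleRel_mapEdgeSet (hσ : IsReflection σ) {e f : G.edgeSet}
    (he : ¬ AngleRel G e (σ.mapEdgeSet e)) (h : AngleRel G e f) :
    ¬ AngleRel G e (σ.mapEdgeSet f) := by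
  intro h'
  have := h'.map σ
  rw [mapEdgeSet_mapEdgeSet hσ] at this
  exact he (ReflTransGen.trans h this.symm)

open Classical in
/-- The colouring in which the class of `e` is red and its mirror image is blue. -/
noncomputable def classColouring (σ : G ≃g G) (e f : G.edgeSet) : RSColour :=
  if AngleRel G e f then .red else if AngleRel G e (σ.mapEdgeSet f) then .blue else .gold

theorem classColouring_eq_red {e f : G.edgeSet} :
    classColouring σ e f = .red ↔ AngleRel G e f := by
  unfold classColouring
  split_ifs <;> simp_all

theorem classColouring_eq_blue (hσ : IsReflection σ) {e f : G.edgeSet}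
    (he : ¬ AngleRel G e (σ.mapEdgeSet e)) :
    classColouring σ e f = .blue ↔ AngleRel G e (σ.mapEdgeSet f) := by
  have := not_angleRel_mapEdgeSet hσ he (f := f)
  unfold classColouring
  split_ifs <;> simp_all

theorem exists_isRSColouring (hσ : IsReflection σ) (hp : Function.Injective p)
    (hsymm : IsReflectionSymmetric σ p) {e : G.edgeSet} (he : ¬ AngleRel G e (σ.mapEdgeSet e))
    {f : V → Plane} (hf : IsPotential p (AngleRel G e) f) :
    ∃ δ : G.edgeSet → RSColour, IsRSColouring σ δ ∧ IsCartesian δ := by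
  have hadj : ∀ ⦃u v⦄, G.Adj u v → p u ≠ p v := fun u v h h' => h.ne (hp h')
  have hg := hf.reflect hsymm
  set δ := classColouring σ e with hδ
  have hR : IsPotential p (fun f => δ f = .red) f := by
    simpa only [hδ, classColouring_eq_red] using hf
  have hB : IsPotential p (fun f => δ f = .blue) (fun v => tau (f (σ v))) := by
    simpa only [hδ, classColouring_eq_blue hσ he] using hg
  -- The gold edges have the potential that remains after subtracting those of red and blue from
  -- `p`. It rules out cycles with a single gold edge.
  have hG := (hR.union hB fun e h h' => by rw [h] at h'; cases h').compl
  have hred : δ e = .red := classColouring_eq_red.2 ReflTransGen.refl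
  have hblue : δ (σ.mapEdgeSet e) = .blue := by
    rw [hδ, classColouring_eq_blue hσ he, mapEdgeSet_mapEdgeSet hσ]
    exact ReflTransGen.refl
  refine ⟨δ, ⟨⟨⟨e, hred⟩, ⟨_, hblue⟩, ?_, ?_, ?_⟩, Or.inl ?_⟩, ?_⟩
  · refine IsNACColouring.of_isPotential hadj (c := .red) ?_ (f := f) ?_
    · rintro (_ | _)
      · exact ⟨e, by simp [hred, RSColour.changeGold]⟩
      · exact ⟨σ.mapEdgeSet e, by beta_reduce; rw [hblue]; rfl⟩
    · convert hR using 2 with e'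
      cases δ e' <;> simp [RSColour.changeGold]
  · refine IsNACColouring.of_isPotential hadj (c := .blue) ?_ (f := fun v => tau (f (σ v))) ?_
    · rintro (_ | _)
      · exact ⟨e, by simp [hred, RSColour.changeGold]⟩
      · exact ⟨σ.mapEdgeSet e, by beta_reduce; rw [hblue]; rfl⟩
    · convert hB using 2 with e'
      cases δ e' <;> simp [RSColour.changeGold]
  · intro e'
    rw [hδ, classColouring_eq_red, classColouring_eq_blue hσ he, mapEdgeSet_mapEdgeSet hσ]
  · rintro v W ⟨hW, e', ⟨he', hgold⟩, hu⟩
    refine hG.ne_of_walk hadj W hW.edges_nodup ⟨e', ⟨he', by simp [hgold]⟩, ?_⟩ rfl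
    rintro e'' ⟨h₁, h₂⟩
    refine hu e'' ⟨h₁, ?_⟩
    revert h₂
    cases δ e'' <;> simp
  · rintro ⟨v, w, hvw, Prb, Prg, Pbg, -, -, -, hrb, hrg, hbg⟩
    -- Each path avoids one colour, so the potential of that colour agrees at `v` and `w`. The three
    -- potentials sum to `p`, whence `p v = p w`.
    have h₁ := hR.eq_of_walk Pbg fun e he h => by rcases hbg e he with h' | h' <;> simp [h] at h'
    have h₂ := hB.eq_of_walk Prg fun e he h => by rcases hrg e he with h' | h' <;> simp [h] at h'
    have h₃ := hG.eq_of_walk Prb fun e he h => h (hrb e he)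
    simp only [Pi.sub_apply, Pi.add_apply] at h₃
    rw [h₁, h₂] at h₃
    exact hvw (hp (sub_left_injective h₃))

end ExistsColouring

open Filter Topology ComplexConjugate

/-! ### Triangles and quadrilaterals in the complex plane. -/

section Complex

/-- The identification of the plane with the complex numbers. -/
noncomputable def toComplex : Plane ≃ₗᵢ[ℝ] ℂ := Complex.orthonormalBasisOneI.repr.symm

theorem toComplex_re (x : Plane) : (toComplex x).re = x 0 := by
  simp [toComplex, ← Complex.orthonormalBasisOneI.sum_repr_symm, Fin.sum_univ_two]

theorem toComplex_im (x : Plane) : (toComplex x).im = x 1 := by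
  simp [toComplex, ← Complex.orthonormalBasisOneI.sum_repr_symm, Fin.sum_univ_two]

theorem toComplex_tau (x : Plane) : toComplex (tau x) = -conj (toComplex x) := by
  apply Complex.ext <;> simp [toComplex_re, toComplex_im, tau]

/-- Circles centred at 0 and -1 meet in a pair of conjugate points. -/
theorem eq_or_eq_conj_of_norm {a b : ℂ} (h₁ : ‖a‖ = ‖b‖) (h₂ : ‖1 + a‖ = ‖1 + b‖) :
    a = b ∨ a.im = -b.im := by
  have e₁ := congrArg (· ^ 2) h₁
  have e₂ := congrArg (· ^ 2) h₂
  simp only [Complex.sq_norm, Complex.normSq_apply, Complex.add_re, Complex.add_im,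
    Complex.one_re, Complex.one_im] at e₁ e₂
  have hre : a.re = b.re := by linarith
  rw [hre] at e₁
  rcases mul_self_eq_mul_self_iff.1 (add_left_cancel e₁) with h | h
  · exact Or.inl (Complex.ext hre h)
  · exact Or.inr h

/-- Side lengths fix a triangle up to a mirror image, which `him` excludes; a degenerate triangle is
its own mirror image. -/
theorem div_eq_div_of_norm {x y x' y' : ℂ} (hx : x ≠ 0) (hy : y ≠ 0) (h₁ : ‖x'‖ = ‖x‖)
    (h₂ : ‖y'‖ = ‖y‖) (h₃ : ‖x' + y'‖ = ‖x + y‖)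
    (him : (y / x).im ≠ 0 → (y' / x').im ≠ -(y / x).im) : x' / x = y' / y := by
  have hx' : x' ≠ 0 := by rwa [← norm_ne_zero_iff, h₁, norm_ne_zero_iff]
  have hρ : y' / x' = y / x := by
    have e₁ : ‖y' / x'‖ = ‖y / x‖ := by rw [norm_div, norm_div, h₁, h₂]
    have e₂ : ‖1 + y' / x'‖ = ‖1 + y / x‖ := by
      rw [one_add_div hx', one_add_div hx, norm_div, norm_div, h₁, h₃]
    rcases eq_or_eq_conj_of_norm e₁ e₂ with h | h
    · exact h
    · have h0 : (y / x).im = 0 := by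
        by_contra hne
        exact him hne h
      have h0' : (y' / x').im = 0 := by rw [h, h0, neg_zero]
      have e₃ := congrArg (· ^ 2) e₁
      have e₄ := congrArg (· ^ 2) e₂
      simp only [Complex.sq_norm, Complex.normSq_apply, Complex.add_re, Complex.add_im,
        Complex.one_re, Complex.one_im, h0, h0'] at e₃ e₄
      exact Complex.ext (by linarith) (by rw [h0, h0'])
  rw [div_eq_div_iff hx' hx] at hρ
  rw [div_eq_div_iff hx hy, mul_comm x' y, ← hρ]

/-- The vector `x - x' = y' - y` is orthogonal to both `x + x'` and `y + y'`, which are linearly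
independent by `hne`. This separates parallelograms from antiparallelograms. -/
theorem eq_of_norm_of_nondegenerate {x y x' y' : ℂ} (h₁ : ‖x‖ = ‖x'‖) (h₂ : ‖y‖ = ‖y'‖)
    (h : x + y = y' + x') (hne : (conj (x + x') * (y + y')).im ≠ 0) : x = x' := by
  have e₁ := congrArg (· ^ 2) h₁
  have e₂ := congrArg (· ^ 2) h₂
  have e₃ := congrArg Complex.re h
  have e₄ := congrArg Complex.im h
  simp only [Complex.sq_norm, Complex.normSq_apply, Complex.add_re, Complex.add_im,
    Complex.mul_im, Complex.conj_re, Complex.conj_im] at e₁ e₂ e₃ e₄ hne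
  obtain ⟨a, b⟩ := x
  obtain ⟨a', b'⟩ := x'
  obtain ⟨c, d⟩ := y
  obtain ⟨c', d'⟩ := y'
  simp only at e₁ e₂ e₃ e₄ hne
  have f₁ : (a - a') * (a + a') + (b - b') * (b + b') = 0 := by linarith
  have f₂ : (a - a') * (c + c') + (b - b') * (d + d') = 0 := by
    rw [show a - a' = c' - c by linarith, show b - b' = d' - d by linarith]; linarith
  have ha : (a - a') * ((a + a') * (d + d') + -(b + b') * (c + c')) = 0 := by
    linear_combination (d + d') * f₁ - (b + b') * f₂
  have hb : (b - b') * ((a + a') * (d + d') + -(b + b') * (c + c')) = 0 := by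
    linear_combination (a + a') * f₂ - (c + c') * f₁
  have ha' := (mul_eq_zero.1 ha).resolve_right hne
  have hb' := (mul_eq_zero.1 hb).resolve_right hne
  exact Complex.ext (sub_eq_zero.1 ha') (sub_eq_zero.1 hb')

theorem exists_real_smul_of_im_eq_zero {x y : ℂ} (hx : x ≠ 0) (h : (conj x * y).im = 0) :
    ∃ k : ℝ, y = k • x := by
  refine ⟨(y / x).re, ?_⟩
  have him : (y / x).im = 0 := by
    rw [Complex.div_im]
    simp only [Complex.mul_im, Complex.conj_re, Complex.conj_im] at h
    rw [← sub_div, div_eq_zero_iff]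
    left; linarith
  rw [Complex.real_smul, show (((y / x).re : ℝ) : ℂ) = y / x from Complex.ext rfl (by simp [him]),
    div_mul_cancel₀ _ hx]

theorem eq_one_of_conj_eq {c : ℂ} (h : conj c = c) (h₁ : ‖c‖ = 1) (hc : c ≠ -1) : c = 1 := by
  obtain ⟨r, rfl⟩ := Complex.conj_eq_iff_real.1 h
  rw [Complex.norm_real, Real.norm_eq_abs] at h₁
  rcases eq_or_eq_neg_of_abs_eq h₁ with rfl | rfl
  · simp
  · simp at hc

end Complex

/-! ### Rigidity of symmetric motions when all classes are invariant. -/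

section Rigidity

variable {V : Type*} {G : SimpleGraph V} {σ : G ≃g G} {p : V → Plane}

/-- The quotient of the edge vector in one placement by that in another one. -/
noncomputable def edgeRatio (p q : V → Plane) : Sym2 V → ℂ :=
  Sym2.lift ⟨fun u v => toComplex (q v - q u) / toComplex (p v - p u), fun u v => by
    beta_reduce
    rw [← neg_sub (q u), ← neg_sub (p u), map_neg, map_neg, neg_div_neg_eq]⟩

@[simp]
theorem edgeRatio_mk (p q : V → Plane) (u v : V) :
    edgeRatio p q s(u, v) = toComplex (q v - q u) / toComplex (p v - p u) := rfl

/-- The reflection acts as `z ↦ -conj z`, and the signs cancel in the quotient. -/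
theorem edgeRatio_map {q : V → Plane} (hp : IsReflectionSymmetric σ p)
    (hq : IsReflectionSymmetric σ q) (e : Sym2 V) :
    edgeRatio p q (e.map σ) = conj (edgeRatio p q e) := by
  induction e with
  | _ u v =>
    rw [Sym2.map_mk, edgeRatio_mk, edgeRatio_mk, hp, hp, hq, hq, ← tau_sub, ← tau_sub,
      toComplex_tau, toComplex_tau, neg_div_neg_eq, map_div₀]

theorem toComplex_sub_ne_zero (hp : IsRealisation G p) {u v : V} (h : G.Adj u v) :
    toComplex (p v - p u) ≠ 0 := by
  rw [Ne, LinearIsometryEquiv.map_eq_zero_iff, sub_eq_zero]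
  exact (hp h).symm

variable {T : Type*} [TopologicalSpace T] {P : T → V → Plane} {t₀ : T}

theorem eventually_edgeRatio_triangle (hp : IsRealisation G p)
    (hP : ∀ v, Continuous fun t => P t v)
    (hlen : ∀ ⦃u v⦄, G.Adj u v → ∀ t, ‖P t u - P t v‖ = ‖p u - p v‖)
    (h₀ : ∀ ⦃u v⦄, G.Adj u v → P t₀ v - P t₀ u = p v - p u) {u v w : V} (h₁ : G.Adj u v)
    (h₂ : G.Adj v w) (h₃ : G.Adj w u) :
    ∀ᶠ t in 𝓝 t₀, edgeRatio p (P t) s(u, v) = edgeRatio p (P t) s(v, w) := by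
  have hd : ∀ a b, Continuous fun t => toComplex (P t b - P t a) := fun a b =>
    toComplex.continuous.comp ((hP b).sub (hP a))
  have hρ : Tendsto (fun t => (toComplex (P t w - P t v) / toComplex (P t v - P t u)).im) (𝓝 t₀)
      (𝓝 (toComplex (p w - p v) / toComplex (p v - p u)).im) := by
    have := ((hd v w).continuousAt (x := t₀)).div ((hd u v).continuousAt (x := t₀))
      (by rw [h₀ h₁]; exact toComplex_sub_ne_zero hp h₁)
    have := (Complex.continuous_im.continuousAt.tendsto).comp this.tendsto
    simp only [Pi.div_apply] at this
    rw [h₀ h₁, h₀ h₂] at this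
    exact this
  -- By continuity, a non-degenerate triangle cannot jump to its mirror image.
  have hev : ∀ᶠ t in 𝓝 t₀, (toComplex (p w - p v) / toComplex (p v - p u)).im ≠ 0 →
      (toComplex (P t w - P t v) / toComplex (P t v - P t u)).im ≠
        -(toComplex (p w - p v) / toComplex (p v - p u)).im := by
    rw [eventually_imp_distrib_left]
    intro hne
    refine hρ.eventually_ne fun h => hne ?_
    linarith
  filter_upwards [hev] with t ht
  rw [edgeRatio_mk, edgeRatio_mk]
  refine div_eq_div_of_norm (toComplex_sub_ne_zero hp h₁) (toComplex_sub_ne_zero hp h₂) ?_ ?_ ?_ ht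
  · rw [LinearIsometryEquiv.norm_map, LinearIsometryEquiv.norm_map, hlen h₁.symm]
  · rw [LinearIsometryEquiv.norm_map, LinearIsometryEquiv.norm_map, hlen h₂.symm]
  · rw [← map_add, ← map_add, LinearIsometryEquiv.norm_map, LinearIsometryEquiv.norm_map,
      sub_add_sub_cancel', sub_add_sub_cancel', hlen h₃]

theorem eventually_edgeRatio_square (hp : IsRealisation G p)
    (hP : ∀ v, Continuous fun t => P t v)
    (hlen : ∀ ⦃u v⦄, G.Adj u v → ∀ t, ‖P t u - P t v‖ = ‖p u - p v‖)
    (h₀ : ∀ ⦃u v⦄, G.Adj u v → P t₀ v - P t₀ u = p v - p u) {u v w x : V} (h₁ : G.Adj u v)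
    (h₂ : G.Adj v w) (h₃ : G.Adj w x) (h₄ : G.Adj x u)
    (h : IsParallelogram (p u) (p v) (p w) (p x)) :
    ∀ᶠ t in 𝓝 t₀, edgeRatio p (P t) s(u, v) = edgeRatio p (P t) s(w, x) := by
  have hd : ∀ a b, Continuous fun t => toComplex (P t b - P t a) := fun a b =>
    toComplex.continuous.comp ((hP b).sub (hP a))
  have hx : p w - p v = p x - p u := by
    have := h.1
    rw [sub_eq_sub_iff_add_eq_add] at this ⊢
    rw [← this, add_comm]
  have hcont : Continuous fun t => (conj (toComplex (P t v - P t u) + toComplex (P t w - P t x)) *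
      (toComplex (P t w - P t v) + toComplex (P t x - P t u))).im :=
    Complex.continuous_im.comp ((Complex.continuous_conj.comp ((hd u v).add (hd x w))).mul
      ((hd v w).add (hd u x)))
  -- At `t₀` both sums are twice a side of the parallelogram, so non-degeneracy makes this
  -- expression non-zero, and it remains so nearby.
  have hne : (conj (toComplex (P t₀ v - P t₀ u) + toComplex (P t₀ w - P t₀ x)) *
      (toComplex (P t₀ w - P t₀ v) + toComplex (P t₀ x - P t₀ u))).im ≠ 0 := by
    rw [h₀ h₁, h₀ h₃.symm, h₀ h₂, h₀ h₄.symm, hx, ← h.1]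
    intro him
    obtain ⟨k, hk⟩ := exists_real_smul_of_im_eq_zero (toComplex_sub_ne_zero hp h₁)
      (y := toComplex (p x - p u)) (by
        rw [← two_mul, ← two_mul, map_mul, Complex.conj_ofNat, mul_mul_mul_comm] at him
        have : ((2 : ℂ) * 2) = ((4 : ℝ) : ℂ) := by norm_num
        rw [this, Complex.im_ofReal_mul] at him
        linarith)
    rw [← map_smul] at hk
    exact not_parallel_of_isParallelogram h k (toComplex.injective hk)
  filter_upwards [hcont.continuousAt.eventually_ne hne] with t ht
  have hkey := eq_of_norm_of_nondegenerate ?_ ?_ ?_ ht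
  · rw [edgeRatio_mk, edgeRatio_mk, hkey, h.1, ← neg_sub (P t w), ← neg_sub (p w), map_neg, map_neg,
      neg_div_neg_eq]
  · rw [LinearIsometryEquiv.norm_map, LinearIsometryEquiv.norm_map, hlen h₁.symm, hlen h₃, h.1]
  · rw [LinearIsometryEquiv.norm_map, LinearIsometryEquiv.norm_map, hlen h₂.symm, hlen h₄, hx]
  · rw [← map_add, ← map_add]
    congr 1
    abel

/-- If all angle-preserving classes are invariant, then a symmetric flex does not change the edge
vectors near an instant at which they are the initial ones. -/
theorem eventually_edgeVector_eq [Finite V] {Q : V → V → V → V → Prop}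
    (hQ : IsParallelogramComplex G p Q) (hp : IsRealisation G p)
    (hsymm : IsReflectionSymmetric σ p) (hinv : ∀ e, AngleRel G e (σ.mapEdgeSet e))
    (hP : ∀ v, Continuous fun t => P t v)
    (hlen : ∀ ⦃u v⦄, G.Adj u v → ∀ t, ‖P t u - P t v‖ = ‖p u - p v‖)
    (hPsymm : ∀ t, IsReflectionSymmetric σ (P t))
    (h₀ : ∀ ⦃u v⦄, G.Adj u v → P t₀ v - P t₀ u = p v - p u) :
    ∀ᶠ t in 𝓝 t₀, ∀ u v, G.Adj u v → P t v - P t u = p v - p u := by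
  have ev₃ : ∀ᶠ t in 𝓝 t₀, ∀ u v w, IsThreeCycle G u v w →
      edgeRatio p (P t) s(u, v) = edgeRatio p (P t) s(v, w) := by
    simp only [eventually_all]
    exact fun u v w h => eventually_edgeRatio_triangle hp hP hlen h₀ h.1 h.2.1 h.2.2
  have ev₄ : ∀ᶠ t in 𝓝 t₀, ∀ u v w x, Q u v w x →
      edgeRatio p (P t) s(u, v) = edgeRatio p (P t) s(w, x) := by
    simp only [eventually_all]
    intro u v w x h
    have h' := hQ.fourCycle h
    exact eventually_edgeRatio_square hp hP hlen h₀ h'.1 h'.2.1 h'.2.2.1 h'.2.2.2.1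
      (hQ.parallelogram h)
  -- The ratios are 1 at `t₀`; staying away from -1 leaves 1 as the only real value of norm one.
  have ev₁ : ∀ᶠ t in 𝓝 t₀, ∀ u v, G.Adj u v → edgeRatio p (P t) s(u, v) ≠ -1 := by
    simp only [eventually_all]
    intro u v h
    have hc : Continuous fun t => edgeRatio p (P t) s(u, v) :=
      (toComplex.continuous.comp ((hP v).sub (hP u))).div_const _
    refine hc.continuousAt.eventually_ne ?_
    rw [edgeRatio_mk, h₀ h, div_self (toComplex_sub_ne_zero hp h)]
    norm_num
  filter_upwards [ev₃, ev₄, ev₁] with t h₃ h₄ h₁ u v h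
  have hrel : ∀ ⦃e f⦄, GenRel G Q e f → edgeRatio p (P t) e.1 = edgeRatio p (P t) f.1 := by
    intro e f hef
    induction hef with
    | refl => rfl
    | tail _ hfg ih =>
      rw [ih]
      rcases hfg with ⟨u, v, w, huvw, hf, hg⟩ | ⟨u, v, w, x, huvwx, hf, hg⟩
      · have e₁ := h₃ u v w huvw
        have e₂ := h₃ v w u ⟨huvw.2.1, huvw.2.2, huvw.1⟩
        have key : ∀ e : Sym2 V, e ∈ ({s(u, v), s(v, w), s(w, u)} : Set (Sym2 V)) →
            edgeRatio p (P t) e = edgeRatio p (P t) s(v, w) := by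
          rintro e (rfl | rfl | rfl)
          exacts [e₁, rfl, e₂.symm]
        rw [key _ hf, key _ hg]
      · rw [hf, hg, h₄ u v w x huvwx]
  have hconj : conj (edgeRatio p (P t) s(u, v)) = edgeRatio p (P t) s(u, v) := by
    rw [← edgeRatio_map hsymm (hPsymm t)]
    have := hinv (edge h)
    rw [← hQ.genRel_eq] at this
    exact (hrel this).symm
  have hnorm : ‖edgeRatio p (P t) s(u, v)‖ = 1 := by
    have hne := toComplex_sub_ne_zero hp h
    rw [edgeRatio_mk, norm_div, LinearIsometryEquiv.norm_map, hlen h.symm,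
      ← toComplex.norm_map (p v - p u), div_self (norm_ne_zero_iff.2 hne)]
  have hone := eq_one_of_conj_eq hconj hnorm (h₁ u v h)
  rw [edgeRatio_mk, div_eq_one_iff_eq (toComplex_sub_ne_zero hp h)] at hone
  exact toComplex.injective hone

theorem hasNonInvariantAngleClass_of_isRSFlexible [Finite V] {Q : V → V → V → V → Prop}
    (hG : G.Connected) (hσ : IsReflection σ) (hQ : IsParallelogramComplex G p Q)
    (hp : IsRealisation G p) (hsymm : IsReflectionSymmetric σ p) (h : IsRSFlexible σ p) :
    HasNonInvariantAngleClass σ := by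
  obtain ⟨P, hP, hPsymm, hnt⟩ := h
  rw [hasNonInvariantAngleClass_iff hσ]
  by_contra! hinv
  have hlen : ∀ ⦃u v⦄, G.Adj u v → ∀ t, ‖P t u - P t v‖ = ‖p u - p v‖ := fun u v h t => by
    rw [hP.length_const h t 0, hP.start, hP.start]
  let S : Set unitInterval := {t | ∀ u v, G.Adj u v → P t v - P t u = p v - p u}
  have hclosed : IsClosed S := by
    have : S = ⋂ u, ⋂ v, ⋂ _ : G.Adj u v, {t | P t v - P t u = p v - p u} := by
      ext t
      simp [S]
    rw [this]
    exact isClosed_iInter fun u => isClosed_iInter fun v => isClosed_iInter fun _ =>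
      isClosed_eq ((hP.continuous v).sub (hP.continuous u)) continuous_const
  have hopen : IsOpen S := isOpen_iff_mem_nhds.2 fun t ht =>
    eventually_edgeVector_eq hQ hp hsymm hinv hP.continuous hlen hPsymm ht
  have hall : S = Set.univ := IsClopen.eq_univ ⟨hclosed, hopen⟩
    ⟨0, fun u v _ => by rw [hP.start, hP.start]⟩
  have := hG.nonempty
  let v₀ : V := Classical.arbitrary V
  -- Since `G` is connected, constant edge vectors mean that all vertices are translated by the same
  -- vector.
  have hconst : ∀ t v, P t v - p v = P t v₀ - p v₀ := by
    intro t v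
    obtain ⟨W⟩ := hG.preconnected v v₀
    clear_value v₀
    induction W with
    | nil => rfl
    | cons h _ ih =>
      rw [← ih]
      have ht : t ∈ S := hall ▸ Set.mem_univ t
      have := ht _ _ h
      rw [sub_eq_sub_iff_add_eq_add] at this ⊢
      rw [add_comm, ← this, add_comm]
  refine hnt ⟨fun t => AffineIsometryEquiv.constVAdd ℝ Plane (P t v₀ - p v₀), fun x => ?_,
    fun x => ?_, fun t v => ?_⟩
  · exact ((hP.continuous v₀).sub continuous_const).add continuous_const
  · simp [hP.start]
  · simp [← hconst t v]

end Rigidity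

/-! ### The flex that counter-rotates a class and its mirror image. -/

section Rotation

variable {V : Type*} {G : SimpleGraph V} {σ : G ≃g G} {p : V → Plane}

/-- The motion that rotates the edges on which `f` changes by the angle of `ω`, and their mirror
images in the opposite sense. -/
noncomputable def counterRotation (σ : G ≃g G) (p f : V → Plane) (ω : ℂ) (v : V) : Plane :=
  toComplex.symm (toComplex (p v) + (ω - 1) * toComplex (f v) +
    (conj ω - 1) * toComplex (tau (f (σ v))))

theorem toComplex_counterRotation_sub (f : V → Plane) (ω : ℂ) (u v : V) :
    toComplex (counterRotation σ p f ω v - counterRotation σ p f ω u) =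
      toComplex (p v - p u) + (ω - 1) * toComplex (f v - f u) +
        (conj ω - 1) * toComplex (tau (f (σ v)) - tau (f (σ u))) := by
  simp only [counterRotation, map_sub, LinearIsometryEquiv.apply_symm_apply]
  ring

/-- Negated conjugation exchanges the `ω` term at `v` with the `conj ω` term at `σ v`. -/
theorem isReflectionSymmetric_counterRotation (hσ : IsReflection σ)
    (hsymm : IsReflectionSymmetric σ p) (f : V → Plane) (ω : ℂ) :
    IsReflectionSymmetric σ (counterRotation σ p f ω) := by
  intro v
  apply toComplex.injective
  simp only [toComplex_tau, counterRotation, LinearIsometryEquiv.apply_symm_apply, hsymm v, hσ.2,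
    map_add, map_mul, map_sub, map_one, map_neg, Complex.conj_conj]
  ring

theorem exists_toComplex_counterRotation_sub (hσ : IsReflection σ)
    (hsymm : IsReflectionSymmetric σ p) {e : G.edgeSet} (he : ¬ AngleRel G e (σ.mapEdgeSet e))
    {f : V → Plane} (hf : IsPotential p (AngleRel G e) f) {ω : ℂ} (hω : ‖ω‖ = 1) {u v : V}
    (h : G.Adj u v) :
    ∃ c : ℂ, ‖c‖ = 1 ∧ (AngleRel G e (edge h) → c = ω) ∧
      toComplex (counterRotation σ p f ω v - counterRotation σ p f ω u) =
        c * toComplex (p v - p u) := by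
  have h₁ := hf h
  have h₂ := hf.reflect hsymm h
  have h₃ := not_angleRel_mapEdgeSet hσ he (f := edge h)
  rw [toComplex_counterRotation_sub, h₁, h₂]
  by_cases hr : AngleRel G e (edge h)
  · refine ⟨ω, hω, fun _ => rfl, ?_⟩
    rw [if_pos hr, if_neg (h₃ hr), map_zero]
    ring
  · rw [if_neg hr]
    by_cases hb : AngleRel G e (σ.mapEdgeSet (edge h))
    · refine ⟨conj ω, by rwa [RCLike.norm_conj], fun h => absurd h hr, ?_⟩
      rw [if_pos hb, map_zero]
      ring
    · refine ⟨1, norm_one, fun h => absurd h hr, ?_⟩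
      rw [if_neg hb, map_zero]
      ring

theorem isRSFlexible_of_potential (hσ : IsReflection σ) (hp : IsRealisation G p)
    (hsymm : IsReflectionSymmetric σ p) {e : G.edgeSet} (he : ¬ AngleRel G e (σ.mapEdgeSet e))
    {f : V → Plane} (hf : IsPotential p (AngleRel G e) f) : IsRSFlexible σ p := by
  let ω : unitInterval → ℂ := fun t => Complex.exp ((Real.pi * t : ℝ) * Complex.I)
  have hω : ∀ t, ‖ω t‖ = 1 := fun t => Complex.norm_exp_ofReal_mul_I _
  have hlen : ∀ ⦃u v⦄, G.Adj u v → ∀ t, ‖counterRotation σ p f (ω t) u -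
      counterRotation σ p f (ω t) v‖ = ‖p u - p v‖ := by
    intro u v h t
    obtain ⟨c, hc, -, hcp⟩ := exists_toComplex_counterRotation_sub hσ hsymm he hf (hω t) h.symm
    rw [← toComplex.norm_map, hcp, norm_mul, hc, one_mul, toComplex.norm_map]
  refine ⟨fun t => counterRotation σ p f (ω t), ⟨fun t u v h huv => ?_, fun v => ?_, fun v => ?_,
    fun u v h s t => by rw [hlen h, hlen h]⟩,
    fun t => isReflectionSymmetric_counterRotation hσ hsymm f _, ?_⟩
  · have := hlen h t
    rw [huv, sub_self, norm_zero, eq_comm, norm_eq_zero, sub_eq_zero] at this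
    exact hp h this
  · have : Continuous ω := by fun_prop
    unfold counterRotation
    have h' : Continuous fun t => conj (ω t) := Complex.continuous_conj.comp this
    fun_prop
  · simp [counterRotation, ω]
  · rintro ⟨g, -, -, hg⟩
    beta_reduce at hg
    obtain ⟨u, v, h, rfl⟩ := exists_edge e
    have hd := toComplex_sub_ne_zero hp h
    -- An isometry preserves the length of the sum of an edge vector and its mirror image. With `z`
    -- the edge vector this sum is `z - conj z`, of norm twice `|z.im|`, while the flex turns `z`
    -- into `ω t * z`.
    have key : ∀ t, (ω t * toComplex (p v - p u)).im ^ 2 = (toComplex (p v - p u)).im ^ 2 := by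
      intro t
      obtain ⟨c, -, hcω, hcp⟩ := exists_toComplex_counterRotation_sub hσ hsymm he hf (hω t) h
      rw [hcω ReflTransGen.refl] at hcp
      have hgL : ∀ x y, g t x - g t y = (g t).linearIsometryEquiv (x - y) := fun x y =>
        ((g t).map_vsub x y).symm
      have hs := isReflectionSymmetric_counterRotation hσ hsymm f (ω t)
      have hn := (g t).linearIsometryEquiv.norm_map (p v - p u + (p (σ v) - p (σ u)))
      rw [map_add, ← hgL, ← hgL, ← hg, ← hg, ← hg, ← hg, hs, hs, hsymm, hsymm, ← tau_sub, ← tau_sub,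
        ← toComplex.norm_map, ← toComplex.norm_map (_ + tau _), map_add, map_add, toComplex_tau,
        toComplex_tau, hcp, ← sub_eq_add_neg, ← sub_eq_add_neg, Complex.sub_conj,
        Complex.sub_conj, norm_mul, norm_mul, Complex.norm_real, Complex.norm_real,
        mul_left_inj' (by simp), Real.norm_eq_abs, Real.norm_eq_abs, ← sq_eq_sq_iff_abs_eq_abs] at hn
      linarith
    -- For `z = a + b i`, the quarter turn gives `a ^ 2 = b ^ 2`, and the eighth turn then gives `a
    -- * b = 0`; together they force `z = 0`.
    have k₁ := key ⟨1 / 2, by norm_num, by norm_num⟩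
    have k₂ := key ⟨1 / 4, by norm_num, by norm_num⟩
    have w₁ : ω ⟨1 / 2, by norm_num, by norm_num⟩ = Complex.I := by
      simp only [ω]
      rw [Complex.exp_mul_I, ← Complex.ofReal_cos, ← Complex.ofReal_sin,
        show Real.pi * (1 / 2) = Real.pi / 2 by ring]
      simp
    have w₂ : ω ⟨1 / 4, by norm_num, by norm_num⟩ =
        (√2 / 2 : ℝ) + (√2 / 2 : ℝ) * Complex.I := by
      simp only [ω]
      rw [Complex.exp_mul_I, ← Complex.ofReal_cos, ← Complex.ofReal_sin,
        show Real.pi * (1 / 4) = Real.pi / 4 by ring, Real.cos_pi_div_four, Real.sin_pi_div_four]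
    rw [w₁] at k₁
    rw [w₂] at k₂
    generalize toComplex (p v - p u) = d at *
    obtain ⟨a, b⟩ := d
    simp only [Complex.mul_im, Complex.add_re, Complex.add_im, Complex.mul_re, Complex.ofReal_re,
      Complex.ofReal_im, Complex.I_re, Complex.I_im] at k₁ k₂
    have hs : √2 ^ 2 = 2 := Real.sq_sqrt (by norm_num)
    have hab : a ^ 2 = b ^ 2 := by linarith
    have hab' : a * b = 0 := by
      have : √2 ^ 2 * (a + b) ^ 2 = 4 * b ^ 2 := by linear_combination 4 * k₂
      rw [hs] at this
      linarith
    apply hd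
    have ha : a = 0 := by
      rcases mul_eq_zero.1 hab' with rfl | rfl
      · rfl
      · simpa using hab
    have hb : b = 0 := by
      rw [ha] at hab
      simpa using hab.symm
    rw [ha, hb]
    rfl

end Rotation

end RSFramework

theorem mainTheorem8 {V : Type*} [Finite V] (G : SimpleGraph V) (hG : G.Connected)
    (σ : G ≃g G) (hσ : RSFramework.IsReflection σ)
    (p : V → RSFramework.Plane) (hp : RSFramework.IsRealisation G p)
    (hsymm : RSFramework.IsReflectionSymmetric σ p)
    (hTP : RSFramework.IsTPFramework G p ∨ RSFramework.IsBracedPFramework G p) :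
    List.TFAE
      [RSFramework.IsRSFlexible σ p,
       ∃ δ : G.edgeSet → RSFramework.RSColour,
         RSFramework.IsRSColouring σ δ ∧ RSFramework.IsCartesian δ,
       RSFramework.HasNonInvariantAngleClass σ] := by
  obtain ⟨Q, hQ⟩ : ∃ Q, RSFramework.IsParallelogramComplex G p Q := by
    rcases hTP with h | h
    · exact ⟨_, h.isParallelogramComplex⟩
    · exact h.isParallelogramComplex
  have hpot := hQ.potential
  rw [hQ.genRel_eq] at hpot
  tfae_have 1 → 3 :=
    RSFramework.hasNonInvariantAngleClass_of_isRSFlexible hG hσ hQ hp hsymm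
  tfae_have 3 → 1 := fun h => by
    obtain ⟨e, he⟩ := (RSFramework.hasNonInvariantAngleClass_iff hσ).1 h
    obtain ⟨f, hf⟩ := hpot e
    exact RSFramework.isRSFlexible_of_potential hσ hp hsymm he hf
  tfae_have 3 → 2 := fun h => by
    obtain ⟨e, he⟩ := (RSFramework.hasNonInvariantAngleClass_iff hσ).1 h
    obtain ⟨f, hf⟩ := hpot e
    exact RSFramework.exists_isRSColouring hσ hQ.injective hsymm he hf
  tfae_have 2 → 3 := fun ⟨_, h, hc⟩ =>
    RSFramework.hasNonInvariantAngleClass_of_isRSColouring hσ h hc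
  tfae_finish
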